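/- All Hilbert spaces are complex. Let $\mathfrak H_0$ be a Hilbert space and $\mathfrak H_1$ a finite-dimensional Hilbert space, let $A_0\in\mathcal L(\mathfrak H_0)$ and $A_1\in\mathcal L(\mathfrak H_1)$ be bounded self-adjoint operators and let $V:\mathfrak H_1\to\mathfrak H_0$ be linear. Assume that $\operatorname{Ran}V$ is a cyclic generating subspace for $A_0$, i.e. $\operatorname{span}\{A_0^k v : k\in\mathbb N_0,\ v\in\operatorname{Ran}V\}$ is dense in $\mathfrak H_0$. Let $$\mathbf B=\begin{pmatrix}A_0&V\\V^*&A_1\end{pmatrix}\quad\text{on }\mathfrak H=\mathfrak H_0\oplus\mathfrak H_1,$$ write $\mathsf E_T$ for the spectral measure of a bounded self-adjoint operator $T$, let $J:\mathfrak H_1\to\mathfrak H$ be the inclusion map, and let $\omega$ be the finite positive Borel measure on $\mathbb R$ given by $\omega(\Delta)=\operatorname{tr}\big(J^*\mathsf E_{\mathbf B}(\Delta)J\big)$. A Borel set $S\subset\mathbb R$ is called a support of a positive Borel measure $\mu$ if $\mu(\mathbb R\setminus S)=0$, and a support $S$ is called minimal if $S\setminus T$ has Lebesgue measure zero for every support $T\subset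 S$ of $\mu$. Singular parts are taken with respect to Lebesgue measure, and the singularly continuous part is the singular part with its atoms removed. Then: 1. The set $$S_s:=\Big\{\lambda\in\mathbb R : \big\|\big[(A_1-\lambda-\mathrm i\varepsilon)-V^*(A_0-\lambda-\mathrm i\varepsilon)^{-1}V\big]^{-1}\big\|\to\infty\text{ as }\varepsilon\to0^+\Big\}$$ is a minimal support of the singular part of $\omega$. 2. The set $S_{pp}$ of all $\lambda\in\mathbb R$ for which there are $0\neq y\in\mathfrak H_1$ with $Vy\in\operatorname{Ran}(A_0-\lambda)$ and $x\in\operatorname{Ran}\mathsf E_{A_0}(\{\lambda\})$ such that $$(A_1-\lambda)y=\lim_{\varepsilon\to0^+}V^*(A_0-\lambda-\mathrm i\varepsilon)^{-1}Vy-V^*x$$ is exactly the set $\{\lambda\in\mathbb R:\omega(\{\lambda\})\neq0\}$ of atoms of $\omega$. 3. The set $S_s\setminus S_{pp}$ is a minimal support of the singularly continuous part of $\omega$. -/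

import Mathlib

open Filter Topology MeasureTheory
open scoped CompactlySupported

noncomputable section

namespace BlockOperator

section SpectralMeasure

variable {H : Type*} [NormedAddCommGroup H] [InnerProductSpace ℂ H] [CompleteSpace H]

theorem inner_cfc_nonneg (T : H →L[ℂ] H) (x : H) (f : ℝ → ℝ) (hf : 0 ≤ f) :
    0 ≤ (inner ℂ x (cfc f T x)).re := by
  have h : 0 ≤ cfc f T := cfc_nonneg fun t _ => hf t
  have h2 := ((ContinuousLinearMap.nonneg_iff_isPositive _).1 h).re_inner_nonneg_right x
  exact h2

/-- The positive linear functional `f ↦ ⟪x, f(T) x⟫` on `C_c(ℝ, ℝ)`, where `f(T)` is given by the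
continuous functional calculus of the self-adjoint operator `T`. -/
def spectralFunctional (T : H →L[ℂ] H) (x : H) : C_c(ℝ, ℝ) →ₚ[ℝ] ℝ :=
  PositiveLinearMap.mk₀
    { toFun := fun f => (inner ℂ x (cfc f T x)).re
      map_add' := fun f g => by
        have h : cfc (⇑(f + g)) T = cfc f T + cfc g T :=
          cfc_add T f g f.continuous.continuousOn g.continuous.continuousOn
        rw [h]
        simp
      map_smul' := fun c f => by
        have h : cfc (⇑(c • f)) T = c • cfc f T := cfc_smul c f T f.continuous.continuousOn
        rw [h, smul_apply, ← Complex.coe_smul, inner_smul_right]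
        simp }
    (fun f hf => inner_cfc_nonneg T x f fun t => hf t)

theorem spectralFunctional_apply (T : H →L[ℂ] H) (x : H) (f : C_c(ℝ, ℝ)) :
    spectralFunctional T x f = (inner ℂ x (cfc f T x)).re := rfl

/-- The spectral measure `Δ ↦ ⟪x, E_T(Δ) x⟫` of the self-adjoint operator `T` at the vector `x`:
the regular Borel measure on `ℝ` with `∫ f dμ = ⟪x, f(T) x⟫` for all `f ∈ C_c(ℝ, ℝ)`. -/
def scalarSpectralMeasure (T : H →L[ℂ] H) (x : H) : Measure ℝ :=
  RealRMK.rieszMeasure (spectralFunctional T x)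

instance (T : H →L[ℂ] H) (x : H) : (scalarSpectralMeasure T x).Regular := by
  unfold scalarSpectralMeasure; infer_instance

theorem integral_scalarSpectralMeasure (T : H →L[ℂ] H) (x : H) (f : C_c(ℝ, ℝ)) :
    ∫ t, f t ∂(scalarSpectralMeasure T x) = (inner ℂ x (cfc f T x)).re :=
  RealRMK.integral_rieszMeasure _ f

theorem scalarSpectralMeasure_le (T : H →L[ℂ] H) (x : H) (s : Set ℝ) :
    scalarSpectralMeasure T x s ≤ ENNReal.ofReal (‖x‖ ^ 2) := by
  refine (measure_mono (Set.subset_univ s)).trans ?_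
  rw [isOpen_univ.measure_eq_iSup_isCompact]
  refine iSup₂_le fun K _ => iSup_le fun hK => ?_
  obtain ⟨f, hf1, -, hfc, hf01⟩ := exists_continuous_one_zero_of_isCompact hK
    isClosed_empty (Set.disjoint_empty K)
  let g : C_c(ℝ, ℝ) := ⟨f, hfc⟩
  refine (RealRMK.rieszMeasure_le_of_eq_one (spectralFunctional T x) (f := g)
    (fun t => (hf01 t).1) hK (fun t ht => hf1 ht)).trans (ENNReal.ofReal_le_ofReal ?_)
  rw [spectralFunctional_apply]
  have h1 : ‖cfc (⇑g) T‖ ≤ 1 := norm_cfc_le zero_le_one fun t _ => by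
    rw [Real.norm_eq_abs, abs_le]
    exact ⟨by linarith [(hf01 t).1, show g t = f t from rfl], (hf01 t).2⟩
  calc (inner ℂ x (cfc (⇑g) T x)).re ≤ ‖inner ℂ x (cfc (⇑g) T x)‖ := Complex.re_le_norm _
    _ ≤ ‖x‖ * ‖cfc (⇑g) T x‖ := norm_inner_le_norm _ _
    _ ≤ ‖x‖ * (1 * ‖x‖) := by
        gcongr
        exact (cfc (⇑g) T).le_of_opNorm_le h1 x
    _ = ‖x‖ ^ 2 := by ring

instance (T : H →L[ℂ] H) (x : H) : IsFiniteMeasure (scalarSpectralMeasure T x) :=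
  ⟨(scalarSpectralMeasure_le T x Set.univ).trans_lt ENNReal.ofReal_lt_top⟩

theorem scalarSpectralMeasure_sum_eq_zero (T : H →L[ℂ] H) (s : Finset H) (c : H → ℝ)
    (h : ∀ A : H →L[ℂ] H, IsSelfAdjoint A → ∑ v ∈ s, c v * (inner ℂ v (A v)).re = 0)
    (Δ : Set ℝ) : ∑ v ∈ s, c v * (scalarSpectralMeasure T v).real Δ = 0 := by
  have key : (∑ v ∈ s, (c v).toNNReal • scalarSpectralMeasure T v)
      = ∑ v ∈ s, (-c v).toNNReal • scalarSpectralMeasure T v := by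
    refine Measure.ext_of_integral_eq_on_compactlySupported fun f => ?_
    have hint : ∀ v (r : NNReal), Integrable f (r • scalarSpectralMeasure T v) := fun v r =>
      f.continuous.integrable_of_hasCompactSupport f.hasCompactSupport
    rw [integral_finsetSum_measure fun v _ => hint v _,
      integral_finsetSum_measure fun v _ => hint v _, ← sub_eq_zero, ← Finset.sum_sub_distrib,
      ← h (cfc f T) (cfc_predicate _ _)]
    refine Finset.sum_congr rfl fun v _ => ?_
    rw [integral_smul_nnreal_measure, integral_smul_nnreal_measure,
      integral_scalarSpectralMeasure, NNReal.smul_def, NNReal.smul_def, smul_eq_mul, smul_eq_mul,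
      ← sub_mul, Real.coe_toNNReal', Real.coe_toNNReal', max_zero_sub_max_neg_zero_eq_self]
  have h2 := congrArg (fun μ : Measure ℝ => μ.real Δ) key
  simp only [Measure.real, Measure.coe_finsetSum, Finset.sum_apply] at h2
  rw [ENNReal.toReal_sum (fun v _ => measure_ne_top _ _),
    ENNReal.toReal_sum (fun v _ => measure_ne_top _ _), ← sub_eq_zero,
    ← Finset.sum_sub_distrib] at h2
  rw [← h2]
  refine Finset.sum_congr rfl fun v _ => ?_
  rw [Measure.smul_apply, Measure.smul_apply, ENNReal.smul_def, ENNReal.smul_def, smul_eq_mul,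
    smul_eq_mul, ENNReal.toReal_mul, ENNReal.toReal_mul, ENNReal.coe_toReal, ENNReal.coe_toReal,
    ← sub_mul, Real.coe_toNNReal', Real.coe_toNNReal', max_zero_sub_max_neg_zero_eq_self]
  rfl

theorem linearCombination_eq_zero (T : H →L[ℂ] H) (Δ : Set ℝ) (c : H →₀ ℂ)
    (h : ∀ A : H →L[ℂ] H, IsSelfAdjoint A →
      Finsupp.linearCombination ℂ (fun v => inner ℂ v (A v)) c = 0) :
    Finsupp.linearCombination ℂ (fun v => ((scalarSpectralMeasure T v).real Δ : ℂ)) c = 0 := by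
  have hreal : ∀ A : H →L[ℂ] H, IsSelfAdjoint A → ∀ v, (inner ℂ v (A v)).im = 0 := by
    intro A hA v
    simpa using hA.isSymmetric.im_inner_self_apply v
  rw [Finsupp.linearCombination_apply, Finsupp.sum]
  apply Complex.ext
  · rw [Complex.re_sum, Complex.zero_re,
      ← scalarSpectralMeasure_sum_eq_zero T c.support (fun v => (c v).re) (fun A hA => ?_) Δ]
    · simp
    · have := congrArg Complex.re (h A hA)
      rw [Finsupp.linearCombination_apply, Finsupp.sum, Complex.re_sum] at this
      simpa [hreal A hA] using this
  · rw [Complex.im_sum, Complex.zero_im,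
      ← scalarSpectralMeasure_sum_eq_zero T c.support (fun v => (c v).im) (fun A hA => ?_) Δ]
    · simp
    · have := congrArg Complex.im (h A hA)
      rw [Finsupp.linearCombination_apply, Finsupp.sum, Complex.im_sum] at this
      simpa [hreal A hA] using this

theorem linearCombination_congr (T : H →L[ℂ] H) (Δ : Set ℝ) (c d : H →₀ ℂ)
    (h : ∀ A : H →L[ℂ] H, IsSelfAdjoint A →
      Finsupp.linearCombination ℂ (fun v => inner ℂ v (A v)) c
        = Finsupp.linearCombination ℂ (fun v => inner ℂ v (A v)) d) :
    Finsupp.linearCombination ℂ (fun v => ((scalarSpectralMeasure T v).real Δ : ℂ)) c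
      = Finsupp.linearCombination ℂ (fun v => ((scalarSpectralMeasure T v).real Δ : ℂ)) d := by
  rw [← sub_eq_zero, ← map_sub]
  refine linearCombination_eq_zero T Δ _ fun A hA => ?_
  rw [map_sub, h A hA, sub_self]

/-- The formal linear combination of vectors in the polarization identity. -/
def polar (v w : H) : H →₀ ℂ :=
  (1 / 4 : ℂ) • (Finsupp.single (w + v) 1 - Finsupp.single (w - v) 1
    + Finsupp.single (w + Complex.I • v) Complex.I - Finsupp.single (w - Complex.I • v) Complex.I)

theorem linearCombination_polar (A : H →L[ℂ] H) (v w : H) :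
    Finsupp.linearCombination ℂ (fun v => inner ℂ v (A v)) (polar v w) = inner ℂ v (A w) := by
  simp only [polar, map_smul, map_sub, map_add, Finsupp.linearCombination_single,
    inner_add_left, inner_add_right, inner_sub_left, inner_sub_right, inner_smul_left,
    inner_smul_right, smul_eq_mul, Complex.conj_I]
  linear_combination (-(1 / 2 : ℂ) * inner ℂ v (A w) + (1 / 2 : ℂ) * inner ℂ w (A v)) *
    Complex.I_sq

/-- The form `⟪v, E_T(Δ) w⟫` obtained by polarization from `⟪x, E_T(Δ) x⟫`. -/
def polarForm (T : H →L[ℂ] H) (Δ : Set ℝ) (v w : H) : ℂ :=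
  Finsupp.linearCombination ℂ (fun x => ((scalarSpectralMeasure T x).real Δ : ℂ)) (polar v w)

theorem polarForm_self (T : H →L[ℂ] H) (Δ : Set ℝ) (v : H) :
    polarForm T Δ v v = ((scalarSpectralMeasure T v).real Δ : ℂ) := by
  have := linearCombination_congr T Δ (polar v v) (Finsupp.single v 1) fun A _ => by
    rw [linearCombination_polar, Finsupp.linearCombination_single, one_smul]
  simpa [polarForm] using this

theorem polarForm_add_right (T : H →L[ℂ] H) (Δ : Set ℝ) (v w w' : H) :
    polarForm T Δ v (w + w') = polarForm T Δ v w + polarForm T Δ v w' := by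
  rw [polarForm, polarForm, polarForm, ← map_add]
  refine linearCombination_congr T Δ _ _ fun A _ => ?_
  simp [linearCombination_polar]

theorem polarForm_smul_right (T : H →L[ℂ] H) (Δ : Set ℝ) (a : ℂ) (v w : H) :
    polarForm T Δ v (a • w) = a * polarForm T Δ v w := by
  rw [polarForm, polarForm, ← smul_eq_mul, ← map_smul]
  refine linearCombination_congr T Δ _ _ fun A _ => ?_
  rw [map_smul, linearCombination_polar, linearCombination_polar, map_smul, inner_smul_right,
    smul_eq_mul]

theorem polarForm_add_left (T : H →L[ℂ] H) (Δ : Set ℝ) (v v' w : H) :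
    polarForm T Δ (v + v') w = polarForm T Δ v w + polarForm T Δ v' w := by
  rw [polarForm, polarForm, polarForm, ← map_add]
  refine linearCombination_congr T Δ _ _ fun A _ => ?_
  simp [linearCombination_polar]

theorem polarForm_smul_left (T : H →L[ℂ] H) (Δ : Set ℝ) (a : ℂ) (v w : H) :
    polarForm T Δ (a • v) w = (starRingEnd ℂ) a * polarForm T Δ v w := by
  rw [polarForm, polarForm, ← smul_eq_mul, ← map_smul]
  refine linearCombination_congr T Δ _ _ fun A _ => ?_
  rw [map_smul, linearCombination_polar, linearCombination_polar, inner_smul_left,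
    smul_eq_mul]

theorem scalarSpectralMeasure_real_le (T : H →L[ℂ] H) (x : H) (Δ : Set ℝ) :
    (scalarSpectralMeasure T x).real Δ ≤ ‖x‖ ^ 2 :=
  ENNReal.toReal_le_of_le_ofReal (sq_nonneg _) (scalarSpectralMeasure_le T x Δ)

theorem norm_polarForm_le_four (T : H →L[ℂ] H) (Δ : Set ℝ) (v w : H) (hv : ‖v‖ = 1)
    (hw : ‖w‖ = 1) : ‖polarForm T Δ v w‖ ≤ 4 := by
  have hq : ∀ x : H, ‖x‖ ≤ 2 → ‖((scalarSpectralMeasure T x).real Δ : ℂ)‖ ≤ 4 := by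
    intro x hx
    rw [Complex.norm_real, Real.norm_of_nonneg measureReal_nonneg]
    refine (scalarSpectralMeasure_real_le T x Δ).trans ?_
    nlinarith [norm_nonneg x]
  have hI : ‖Complex.I • v‖ = 1 := by rw [norm_smul, Complex.norm_I, hv, one_mul]
  have h1 := hq (w + v) ((norm_add_le _ _).trans (by linarith))
  have h2 := hq (w - v) ((norm_sub_le _ _).trans (by linarith))
  have h3 := hq (w + Complex.I • v) ((norm_add_le _ _).trans (by linarith))
  have h4 := hq (w - Complex.I • v) ((norm_sub_le _ _).trans (by linarith))
  simp only [polarForm, polar, map_smul, map_sub, map_add, Finsupp.linearCombination_single,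
    smul_eq_mul, one_mul]
  rw [norm_mul]
  have h5 : ‖(1 / 4 : ℂ)‖ = 1 / 4 := by norm_num
  rw [h5]
  have hmI : ∀ z : ℂ, ‖Complex.I * z‖ = ‖z‖ := fun z => by rw [norm_mul, Complex.norm_I, one_mul]
  have h6 := norm_sub_le_of_le (norm_add_le_of_le (norm_sub_le_of_le h1 h2)
    ((hmI _).trans_le h3)) ((hmI _).trans_le h4)
  linarith

theorem norm_polarForm_le (T : H →L[ℂ] H) (Δ : Set ℝ) (v w : H) :
    ‖polarForm T Δ v w‖ ≤ 4 * ‖v‖ * ‖w‖ := by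
  rcases eq_or_ne v 0 with rfl | hv
  · have := polarForm_smul_left T Δ 0 0 w
    simp_all
  rcases eq_or_ne w 0 with rfl | hw
  · have := polarForm_smul_right T Δ 0 v 0
    simp_all
  have hv' : v = (‖v‖ : ℂ) • ((‖v‖⁻¹ : ℂ) • v) := by
    rw [smul_smul, mul_inv_cancel₀ (by simpa using hv), one_smul]
  have hw' : w = (‖w‖ : ℂ) • ((‖w‖⁻¹ : ℂ) • w) := by
    rw [smul_smul, mul_inv_cancel₀ (by simpa using hw), one_smul]
  have h := norm_polarForm_le_four T Δ ((‖v‖⁻¹ : ℂ) • v) ((‖w‖⁻¹ : ℂ) • w)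
    (by simp [norm_smul, hv]) (by simp [norm_smul, hw])
  conv_lhs => rw [hv', hw']
  rw [polarForm_smul_left, polarForm_smul_right]
  simp only [norm_mul, Complex.conj_ofReal, Complex.norm_real, norm_norm]
  nlinarith [mul_nonneg (norm_nonneg v) (norm_nonneg w)]

/-- The spectral measure `E_T` of the self-adjoint operator `T`: `E_T(Δ)` is the unique bounded
operator with `⟪x, E_T(Δ) x⟫ = μ_{T,x}(Δ)` for all `x`, where `μ_{T,x}` is
`scalarSpectralMeasure T x`. -/
def spectralMeasure (T : H →L[ℂ] H) (Δ : Set ℝ) : H →L[ℂ] H :=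
  InnerProductSpace.continuousLinearMapOfBilin (𝕜 := ℂ)
    (LinearMap.mkContinuous₂
      (LinearMap.mk₂'ₛₗ (starRingEnd ℂ) (RingHom.id ℂ) (polarForm T Δ)
        (polarForm_add_left T Δ) (polarForm_smul_left T Δ)
        (polarForm_add_right T Δ) (polarForm_smul_right T Δ))
      4 (norm_polarForm_le T Δ))

theorem inner_spectralMeasure_self (T : H →L[ℂ] H) (Δ : Set ℝ) (x : H) :
    inner ℂ x (spectralMeasure T Δ x) = ((scalarSpectralMeasure T x).real Δ : ℂ) := by
  rw [← inner_conj_symm, spectralMeasure, InnerProductSpace.continuousLinearMapOfBilin_apply]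
  exact (congrArg _ (polarForm_self T Δ x)).trans (Complex.conj_ofReal _)

end SpectralMeasure

section Supports

/-- A Borel set `S ⊆ ℝ` is a support of `μ` if `μ(ℝ \ S) = 0`. -/
def IsSupport (S : Set ℝ) (μ : Measure ℝ) : Prop :=
  MeasurableSet S ∧ μ Sᶜ = 0

/-- A support `S` of `μ` is minimal if `S \ T` has Lebesgue measure zero for every support
`T ⊆ S` of `μ`. -/
def IsMinimalSupport (S : Set ℝ) (μ : Measure ℝ) : Prop :=
  IsSupport S μ ∧ ∀ T : Set ℝ, T ⊆ S → IsSupport T μ → volume (S \ T) = 0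

/-- The set of atoms of `μ`. -/
def atoms (μ : Measure ℝ) : Set ℝ := {t | μ {t} ≠ 0}

/-- The singularly continuous part of `μ`: the singular part with respect to Lebesgue measure,
with its atoms removed. -/
def singularContinuousPart (μ : Measure ℝ) : Measure ℝ :=
  (μ.singularPart volume).restrict (atoms (μ.singularPart volume))ᶜ

end Supports

section Block

/-- `U` is a cyclic generating subspace for `T`: the span of all `T ^ k u`, `u ∈ U`, is dense. -/
def IsCyclicGeneratingSubspace {H : Type*} [NormedAddCommGroup H] [InnerProductSpace ℂ H]
    (T : H →L[ℂ] H) (U : Submodule ℂ H) : Prop :=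
  Dense (Submodule.span ℂ {w : H | ∃ k : ℕ, ∃ u ∈ U, w = (T ^ k) u} : Set H)

variable {H₀ H₁ : Type*}
  [NormedAddCommGroup H₀] [InnerProductSpace ℂ H₀] [CompleteSpace H₀]
  [NormedAddCommGroup H₁] [InnerProductSpace ℂ H₁] [CompleteSpace H₁]

/-- The operator block matrix `B = [[A₀, V], [V*, A₁]]` on the Hilbert space `H₀ ⊕ H₁`. -/
def blockOperator (A₀ : H₀ →L[ℂ] H₀) (A₁ : H₁ →L[ℂ] H₁) (V : H₁ →L[ℂ] H₀) :
    WithLp 2 (H₀ × H₁) →L[ℂ] WithLp 2 (H₀ × H₁) :=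
  (WithLp.prodContinuousLinearEquiv 2 ℂ H₀ H₁).symm.toContinuousLinearMap ∘L
    ((A₀.coprod V).prod ((ContinuousLinearMap.adjoint V).coprod A₁)) ∘L
    (WithLp.prodContinuousLinearEquiv 2 ℂ H₀ H₁).toContinuousLinearMap

theorem blockOperator_apply (A₀ : H₀ →L[ℂ] H₀) (A₁ : H₁ →L[ℂ] H₁) (V : H₁ →L[ℂ] H₀)
    (x : WithLp 2 (H₀ × H₁)) : blockOperator A₀ A₁ V x =
      WithLp.toLp 2 (A₀ x.fst + V x.snd, ContinuousLinearMap.adjoint V x.fst + A₁ x.snd) := rfl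

theorem blockOperator_isSelfAdjoint {A₀ : H₀ →L[ℂ] H₀} {A₁ : H₁ →L[ℂ] H₁}
    (hA₀ : IsSelfAdjoint A₀) (hA₁ : IsSelfAdjoint A₁) (V : H₁ →L[ℂ] H₀) :
    IsSelfAdjoint (blockOperator A₀ A₁ V) := by
  rw [ContinuousLinearMap.isSelfAdjoint_iff_isSymmetric]
  intro x y
  have h0 := hA₀.isSymmetric x.fst y.fst
  have h1 := hA₁.isSymmetric x.snd y.snd
  simp only [ContinuousLinearMap.coe_coe] at h0 h1
  change inner ℂ (A₀ x.fst + V x.snd) y.fst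
      + inner ℂ (ContinuousLinearMap.adjoint V x.fst + A₁ x.snd) y.snd
    = inner ℂ x.fst (A₀ y.fst + V y.snd)
      + inner ℂ x.snd (ContinuousLinearMap.adjoint V y.fst + A₁ y.snd)
  simp only [inner_add_left, inner_add_right, ContinuousLinearMap.adjoint_inner_left,
    ContinuousLinearMap.adjoint_inner_right, h0, h1]
  ring

/-- The inclusion map `J : H₁ → H₀ ⊕ H₁`. -/
def inclusion (H₀ H₁ : Type*)
    [NormedAddCommGroup H₀] [InnerProductSpace ℂ H₀]
    [NormedAddCommGroup H₁] [InnerProductSpace ℂ H₁] :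
    H₁ →L[ℂ] WithLp 2 (H₀ × H₁) :=
  (WithLp.prodContinuousLinearEquiv 2 ℂ H₀ H₁).symm.toContinuousLinearMap ∘L
    ContinuousLinearMap.inr ℂ H₀ H₁

/-- The positive measure `ω(Δ) = tr (J* E_B(Δ) J)`, written as the sum of the measures
`⟪J eᵢ, E_B(Δ) J eᵢ⟫` over an orthonormal basis `(eᵢ)` of `H₁`; see `omega_apply`. -/
def omega [FiniteDimensional ℂ H₁] (A₀ : H₀ →L[ℂ] H₀) (A₁ : H₁ →L[ℂ] H₁) (V : H₁ →L[ℂ] H₀) :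
    Measure ℝ :=
  ∑ i, scalarSpectralMeasure (blockOperator A₀ A₁ V)
    (inclusion H₀ H₁ (stdOrthonormalBasis ℂ H₁ i))

theorem omega_apply [FiniteDimensional ℂ H₁] (A₀ : H₀ →L[ℂ] H₀) (A₁ : H₁ →L[ℂ] H₁)
    (V : H₁ →L[ℂ] H₀) (Δ : Set ℝ) :
    ((omega A₀ A₁ V).real Δ : ℂ) = LinearMap.trace ℂ H₁
      (ContinuousLinearMap.adjoint (inclusion H₀ H₁) ∘L
        spectralMeasure (blockOperator A₀ A₁ V) Δ ∘L inclusion H₀ H₁ : H₁ →L[ℂ] H₁) := by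
  rw [LinearMap.trace_eq_sum_inner _ (stdOrthonormalBasis ℂ H₁), omega, Measure.real,
    Measure.coe_finsetSum, Finset.sum_apply, ENNReal.toReal_sum fun v _ => measure_ne_top _ _,
    Complex.ofReal_sum]
  refine Finset.sum_congr rfl fun i _ => ?_
  simp only [ContinuousLinearMap.coe_coe, ContinuousLinearMap.comp_apply,
    ContinuousLinearMap.adjoint_inner_right]
  exact (inner_spectralMeasure_self _ Δ _).symm

/-- The resolvent `(T - z)⁻¹`. -/
def res {H : Type*} [NormedAddCommGroup H] [InnerProductSpace ℂ H] (T : H →L[ℂ] H) (z : ℂ) :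
    H →L[ℂ] H :=
  Ring.inverse (T - z • ContinuousLinearMap.id ℂ H)

/-- `M(z) = [(A₁ - z) - V* (A₀ - z)⁻¹ V]⁻¹`. -/
def schurInverse (A₀ : H₀ →L[ℂ] H₀) (A₁ : H₁ →L[ℂ] H₁) (V : H₁ →L[ℂ] H₀) (z : ℂ) :
    H₁ →L[ℂ] H₁ :=
  Ring.inverse ((A₁ - z • ContinuousLinearMap.id ℂ H₁) -
    ContinuousLinearMap.adjoint V ∘L res A₀ z ∘L V)

/-- The set `S_s` of all real `t` with `‖M(t + iε)‖ → ∞` as `ε → 0⁺`. -/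
def singularSet (A₀ : H₀ →L[ℂ] H₀) (A₁ : H₁ →L[ℂ] H₁) (V : H₁ →L[ℂ] H₀) : Set ℝ :=
  {t : ℝ | Tendsto (fun ε : ℝ => ‖schurInverse A₀ A₁ V (t + Complex.I * ε)‖) (𝓝[>] 0) atTop}

/-- The set `S_pp` of all real `t` for which there are `0 ≠ y ∈ H₁` with `V y ∈ Ran (A₀ - t)` and
`x ∈ Ran E_{A₀}({t})` such that
`(A₁ - t) y = lim_{ε → 0⁺} V* (A₀ - t - iε)⁻¹ V y - V* x`. -/
def pointSet (A₀ : H₀ →L[ℂ] H₀) (A₁ : H₁ →L[ℂ] H₁) (V : H₁ →L[ℂ] H₀) : Set ℝ :=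
  {t : ℝ | ∃ y : H₁, y ≠ 0 ∧ (∃ u : H₀, V y = A₀ u - (t : ℂ) • u) ∧
    ∃ x : H₀, (∃ u : H₀, x = spectralMeasure A₀ {t} u) ∧
      ∃ l : H₁,
        Tendsto (fun ε : ℝ =>
          ContinuousLinearMap.adjoint V (res A₀ (t + Complex.I * ε) (V y))) (𝓝[>] 0) (𝓝 l) ∧
        A₁ y - (t : ℂ) • y = l - ContinuousLinearMap.adjoint V x}

end Block

end BlockOperator

end

/-! By block elimination, `schurInverse` is the compressed resolvent M(z) = J*(B - z)⁻¹J
(`schurInverse_eq`). Each ⟪v, M(z)v⟫ is therefore the Borel transform of the spectral measure of B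
at Jv, and all three claims concern boundary values of such transforms.

S_s is Lebesgue null. By polarization ‖M‖ is at most a constant times a finite sum of moduli of
Herglotz functions F. A square root g of F + i takes values in the closed first quadrant, so |g| ≤
Re g + Im g. Cauchy's theorem on rectangles then bounds the integrals of √|F| over horizontal
segments uniformly in the height, and Fatou's lemma excludes divergence on a set of positive measure
(`volume_setOf_tendsto_sum_sqrt_norm_atTop`). Minimality of a null support is automatic.

S_s carries the singular part. Almost everywhere for that part, ω([t - ε, t + ε])/(2ε) → ∞ by
Besicovitch differentiation, and a Poisson kernel estimate bounds this quotient by dim H₁ · ‖M(t +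
iε)‖ (`singularPart_compl_singularSet`).

Atoms. Since -iε(T - t - iε)⁻¹ → E_T({t}) weakly, the condition defining S_pp says that B has an
eigenvector at t with nonzero H₁-component (`mem_pointSet_iff`). Cyclicity rules out eigenvectors
lying in H₀, so this matches the atoms of ω (`pointSet_eq_atoms`). Removing these countably many
points gives the singularly continuous part. -/

namespace BlockOperator

/-! ### Resolvents as Borel transforms, and spectral projections at a point as their limits. -/

section Resolvent

variable {H : Type*} [NormedAddCommGroup H] [InnerProductSpace ℂ H] [CompleteSpace H]

/-- The Riesz measure is known only against compactly supported functions. Multiplying f by cutoffs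
equal to 1 on the spectrum leaves the functional calculus unchanged, while dominated convergence
recovers the integral of f. -/
theorem integral_scalarSpectralMeasure_of_bounded (T : H →L[ℂ] H) (x : H) {f : ℝ → ℝ}
    (hf : Continuous f) {C : ℝ} (hC : ∀ t, ‖f t‖ ≤ C) :
    ∫ t, f t ∂(scalarSpectralMeasure T x) = (inner ℂ x (cfc f T x)).re := by
  obtain ⟨R, hR⟩ := (spectrum.isCompact (𝕜 := ℝ) T).isBounded.subset_closedBall 0
  choose χ hχ1 _ hχc hχ01 using fun n : ℕ => exists_continuous_one_zero_of_isCompact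
    (isCompact_closedBall (0 : ℝ) (R + n)) isClosed_empty (Set.disjoint_empty _)
  have hval : ∀ n, ∫ t, χ n t * f t ∂(scalarSpectralMeasure T x) = (inner ℂ x (cfc f T x)).re := by
    intro n
    let g : C_c(ℝ, ℝ) := ⟨⟨fun t => χ n t * f t, (χ n).continuous.mul hf⟩, (hχc n).mul_right⟩
    refine (integral_scalarSpectralMeasure T x g).trans ?_
    have : cfc (⇑g) T = cfc f T := cfc_congr fun t ht => by
      have h : t ∈ Metric.closedBall (0 : ℝ) (R + n) :=
        Metric.closedBall_subset_closedBall (by simp) (hR ht)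
      change χ n t * f t = f t
      rw [hχ1 n h, Pi.one_apply, one_mul]
    rw [this]
  have hlim : Tendsto (fun n => ∫ t, χ n t * f t ∂(scalarSpectralMeasure T x)) atTop
      (𝓝 (∫ t, f t ∂(scalarSpectralMeasure T x))) := by
    refine tendsto_integral_of_dominated_convergence (fun _ => C)
      (fun n => ((χ n).continuous.mul hf).aestronglyMeasurable) (integrable_const C)
      (fun n => ae_of_all _ fun t => ?_) (ae_of_all _ fun t => ?_)
    · rw [norm_mul, Real.norm_of_nonneg (hχ01 n t).1]
      exact (mul_le_of_le_one_left (norm_nonneg _) (hχ01 n t).2).trans (hC t)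
    · refine tendsto_const_nhds.congr' ?_
      obtain ⟨N, hN⟩ := exists_nat_ge (|t| - R)
      filter_upwards [eventually_ge_atTop N] with n hn
      have hn' : (N : ℝ) ≤ n := by exact_mod_cast hn
      have h : t ∈ Metric.closedBall (0 : ℝ) (R + n) := by
        rw [mem_closedBall_zero_iff, Real.norm_eq_abs]; linarith
      rw [hχ1 n h, Pi.one_apply, one_mul]
  simp only [hval] at hlim
  exact tendsto_nhds_unique hlim tendsto_const_nhds |>.symm ▸ rfl

theorem isUnit_sub_smul_id {T : H →L[ℂ] H} (hT : IsSelfAdjoint T) {z : ℂ} (hz : z.im ≠ 0) :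
    IsUnit (T - z • ContinuousLinearMap.id ℂ H) := by
  have h : z ∉ spectrum ℂ T := fun h => hz <| by
    rw [hT.mem_spectrum_eq_re h]; simp
  rw [spectrum.notMem_iff] at h
  have := h.neg
  rwa [neg_sub] at this

theorem sub_mul_res {T : H →L[ℂ] H} (hT : IsSelfAdjoint T) {z : ℂ} (hz : z.im ≠ 0) :
    (T - z • ContinuousLinearMap.id ℂ H) * res T z = 1 :=
  Ring.mul_inverse_cancel _ (isUnit_sub_smul_id hT hz)

theorem res_mul_sub {T : H →L[ℂ] H} (hT : IsSelfAdjoint T) {z : ℂ} (hz : z.im ≠ 0) :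
    res T z * (T - z • ContinuousLinearMap.id ℂ H) = 1 :=
  Ring.inverse_mul_cancel _ (isUnit_sub_smul_id hT hz)

theorem sub_smul_res_apply {T : H →L[ℂ] H} (hT : IsSelfAdjoint T) {z : ℂ} (hz : z.im ≠ 0)
    (x : H) : T (res T z x) - z • res T z x = x := by
  simpa using congrArg (fun A : H →L[ℂ] H => A x) (sub_mul_res hT hz)

theorem res_sub_smul_apply {T : H →L[ℂ] H} (hT : IsSelfAdjoint T) {z : ℂ} (hz : z.im ≠ 0)
    (x : H) : res T z (T x - z • x) = x := by
  simpa using congrArg (fun A : H →L[ℂ] H => A x) (res_mul_sub hT hz)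

theorem continuous_sub_div (a b : ℝ) (hb : b ≠ 0) :
    Continuous fun s : ℝ => (s - a) / ((s - a) ^ 2 + b ^ 2) :=
  Continuous.div (by fun_prop) (by fun_prop) fun s => by positivity

theorem continuous_const_div (a b : ℝ) (hb : b ≠ 0) :
    Continuous fun s : ℝ => b / ((s - a) ^ 2 + b ^ 2) :=
  Continuous.div (by fun_prop) (by fun_prop) fun s => by positivity

/-- The functional calculus in use is real, so 1/(s - z) is split into real and imaginary parts.
Their combination is checked to be a right inverse of T - z, which is already known to be
invertible. -/
theorem res_eq_cfc {T : H →L[ℂ] H} (hT : IsSelfAdjoint T) {z : ℂ} (hz : z.im ≠ 0) :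
    res T z = cfc (fun s : ℝ => (s - z.re) / ((s - z.re) ^ 2 + z.im ^ 2)) T
      + Complex.I • cfc (fun s : ℝ => z.im / ((s - z.re) ^ 2 + z.im ^ 2)) T := by
  set r : ℝ → ℝ := fun s => (s - z.re) / ((s - z.re) ^ 2 + z.im ^ 2) with hr
  set m : ℝ → ℝ := fun s => z.im / ((s - z.re) ^ 2 + z.im ^ 2) with hm
  have hrc : Continuous r := continuous_sub_div _ _ hz
  have hmc : Continuous m := continuous_const_div _ _ hz
  have hpos : ∀ s : ℝ, (s - z.re) ^ 2 + z.im ^ 2 ≠ 0 := fun s => by positivity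
  set D : H →L[ℂ] H := cfc (fun s : ℝ => s - z.re) T with hD
  have hD' : T - z • ContinuousLinearMap.id ℂ H = D - (Complex.I * z.im) • (1 : H →L[ℂ] H) := by
    have h1 : D = T - algebraMap ℝ (H →L[ℂ] H) z.re := by
      rw [hD, cfc_sub (fun s : ℝ => s) (fun _ => z.re) T, cfc_id' ℝ T, cfc_const z.re T]
    have h2 : algebraMap ℝ (H →L[ℂ] H) z.re = (z.re : ℂ) • (1 : H →L[ℂ] H) := by
      rw [Algebra.algebraMap_eq_smul_one]; rfl
    rw [h1, h2, sub_sub, ← add_smul, mul_comm, Complex.re_add_im]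
    rfl
  have e1 : D * cfc r T = 1 - (z.im : ℂ) • cfc m T := by
    rw [hD, ← cfc_mul (fun s : ℝ => s - z.re) r T, ← cfc_one ℝ T]
    rw [Complex.coe_smul, ← cfc_smul z.im m T, ← cfc_sub _ _ T (by fun_prop) (by fun_prop)]
    refine cfc_congr fun s _ => ?_
    simp only [hr, hm, smul_eq_mul]
    rw [Pi.one_apply]
    field_simp [hpos s]
    ring
  have e2 : D * cfc m T = (z.im : ℂ) • cfc r T := by
    rw [hD, ← cfc_mul (fun s : ℝ => s - z.re) m T]
    rw [Complex.coe_smul, ← cfc_smul z.im r T]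
    refine cfc_congr fun s _ => ?_
    simp only [hr, hm, smul_eq_mul]
    ring
  have key : (T - z • ContinuousLinearMap.id ℂ H) * (cfc r T + Complex.I • cfc m T) = 1 := by
    rw [hD', sub_mul, mul_add, e1, mul_smul_comm, e2, smul_mul_assoc, one_mul, smul_add, smul_smul,
      smul_smul, mul_right_comm, Complex.I_mul_I, neg_one_mul, neg_smul]
    abel
  calc res T z = res T z * ((T - z • ContinuousLinearMap.id ℂ H) *
        (cfc r T + Complex.I • cfc m T)) := by rw [key, mul_one]
    _ = _ := by rw [← mul_assoc, res_mul_sub hT hz, one_mul]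

theorem norm_inv_ofReal_sub_le (s : ℝ) {z : ℂ} (hz : z.im ≠ 0) :
    ‖((s : ℂ) - z)⁻¹‖ ≤ |z.im|⁻¹ := by
  rw [norm_inv]
  refine inv_anti₀ (abs_pos.2 hz) ?_
  simpa using Complex.abs_im_le_norm ((s : ℂ) - z)

theorem continuous_inv_ofReal_sub {z : ℂ} (hz : z.im ≠ 0) :
    Continuous fun s : ℝ => ((s : ℂ) - z)⁻¹ :=
  Continuous.inv₀ (by fun_prop) fun s h => hz <| by
    simpa using congrArg Complex.im h

theorem integrable_inv_ofReal_sub (μ : Measure ℝ) [IsFiniteMeasure μ] {z : ℂ} (hz : z.im ≠ 0) :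
    Integrable (fun s : ℝ => ((s : ℂ) - z)⁻¹) μ :=
  (integrable_const (|z.im|⁻¹)).mono' (continuous_inv_ofReal_sub hz).aestronglyMeasurable
    (ae_of_all _ fun s => norm_inv_ofReal_sub_le s hz)

theorem inner_cfc_self_eq_re (T : H →L[ℂ] H) (x : H) (f : ℝ → ℝ) :
    inner ℂ x (cfc f T x) = (((inner ℂ x (cfc f T x)).re : ℝ) : ℂ) := by
  have := (cfc_predicate f T : IsSelfAdjoint (cfc f T)).isSymmetric.im_inner_self_apply x
  apply Complex.ext
  · simp
  · simpa using this

theorem inner_res_self {T : H →L[ℂ] H} (hT : IsSelfAdjoint T) {z : ℂ} (hz : z.im ≠ 0) (x : H) :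
    inner ℂ x (res T z x) = ∫ s : ℝ, ((s : ℂ) - z)⁻¹ ∂(scalarSpectralMeasure T x) := by
  have hre : ∀ s : ℝ, (s - z.re) / ((s - z.re) ^ 2 + z.im ^ 2) = (((s : ℂ) - z)⁻¹).re := fun s => by
    simp [Complex.inv_re, Complex.normSq_apply, pow_two]
  have him : ∀ s : ℝ, z.im / ((s - z.re) ^ 2 + z.im ^ 2) = (((s : ℂ) - z)⁻¹).im := fun s => by
    simp [Complex.inv_im, Complex.normSq_apply, pow_two]
  have h1 := integral_scalarSpectralMeasure_of_bounded T x (continuous_sub_div z.re z.im hz)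
    (C := |z.im|⁻¹) fun s => by
      rw [hre]
      exact (Complex.abs_re_le_norm _).trans (norm_inv_ofReal_sub_le s hz)
  have h2 := integral_scalarSpectralMeasure_of_bounded T x (continuous_const_div z.re z.im hz)
    (C := |z.im|⁻¹) fun s => by
      rw [him]
      exact (Complex.abs_im_le_norm _).trans (norm_inv_ofReal_sub_le s hz)
  rw [res_eq_cfc hT hz, add_apply, smul_apply, inner_add_right, inner_smul_right,
    inner_cfc_self_eq_re, inner_cfc_self_eq_re T x fun s : ℝ => z.im / _, ← h1, ← h2]
  simp_rw [hre, him]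
  rw [mul_comm]
  exact integral_re_add_im (𝕜 := ℂ) (integrable_inv_ofReal_sub _ hz)

theorem inner_spectralMeasure (T : H →L[ℂ] H) (Δ : Set ℝ) (v w : H) :
    inner ℂ v (spectralMeasure T Δ w) = polarForm T Δ v w := by
  rw [← linearCombination_polar (spectralMeasure T Δ) v w, polarForm]
  simp_rw [inner_spectralMeasure_self]

theorem add_I_mul_im (t ε : ℝ) : ((t : ℂ) + Complex.I * ε).im = ε := by simp

/-- The kernel -iε/(s - t - iε) is bounded by 1 and converges pointwise to the indicator of {t}. -/
theorem tendsto_integral_kernel (μ : Measure ℝ) [IsFiniteMeasure μ] (t : ℝ) :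
    Tendsto (fun ε : ℝ => -(Complex.I * ε) * ∫ s : ℝ, ((s : ℂ) - (t + Complex.I * ε))⁻¹ ∂μ)
      (𝓝[>] 0) (𝓝 (μ.real {t} : ℂ)) := by
  have h1 : (μ.real {t} : ℂ) = ∫ s, Set.indicator {t} (fun _ => (1 : ℂ)) s ∂μ := by
    rw [integral_indicator_const _ (measurableSet_singleton t)]; simp
  simp_rw [h1, ← integral_const_mul]
  refine tendsto_integral_filter_of_dominated_convergence (fun _ => 1) ?_ ?_
    (integrable_const 1) (ae_of_all _ fun s => ?_)
  · filter_upwards [self_mem_nhdsWithin] with ε (hε : 0 < ε)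
    have hz : ((t : ℂ) + Complex.I * ε).im ≠ 0 := by rw [add_I_mul_im]; exact hε.ne'
    exact ((continuous_inv_ofReal_sub hz).const_mul _).aestronglyMeasurable
  · filter_upwards [self_mem_nhdsWithin] with ε (hε : 0 < ε)
    have hz : ((t : ℂ) + Complex.I * ε).im ≠ 0 := by rw [add_I_mul_im]; exact hε.ne'
    refine ae_of_all _ fun s => ?_
    rw [norm_mul]
    have := norm_inv_ofReal_sub_le s hz
    rw [add_I_mul_im, abs_of_pos hε] at this
    calc _ ≤ ε * ε⁻¹ := by
          gcongr
          simp [abs_of_pos hε]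
      _ = 1 := mul_inv_cancel₀ hε.ne'
  · by_cases hs : s = t
    · subst hs
      refine tendsto_const_nhds.congr' ?_
      filter_upwards [self_mem_nhdsWithin] with ε (hε : 0 < ε)
      have : Complex.I * (ε : ℂ) ≠ 0 := by simp [hε.ne']
      rw [sub_add_cancel_left, mul_inv_cancel₀ (neg_ne_zero.2 this)]
      simp
    · rw [Set.indicator_of_notMem (by simpa using hs)]
      have hst : (s : ℂ) - (t + Complex.I * ((0 : ℝ) : ℂ)) ≠ 0 := by
        simpa [sub_eq_zero] using hs
      have : ContinuousAt
          (fun ε : ℝ => -(Complex.I * ε) * ((s : ℂ) - (t + Complex.I * (ε : ℂ)))⁻¹) 0 :=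
        ContinuousAt.mul (by fun_prop) (ContinuousAt.inv₀ (by fun_prop) hst)
      have h2 := this.tendsto
      simp only [Complex.ofReal_zero, mul_zero, neg_zero, zero_mul] at h2
      exact h2.mono_left nhdsWithin_le_nhds

theorem tendsto_inner_res {T : H →L[ℂ] H} (hT : IsSelfAdjoint T) (t : ℝ) (v w : H) :
    Tendsto (fun ε : ℝ => -(Complex.I * ε) * inner ℂ v (res T (t + Complex.I * ε) w))
      (𝓝[>] 0) (𝓝 (inner ℂ v (spectralMeasure T {t} w))) := by
  have hself : ∀ x, Tendsto
      (fun ε : ℝ => -(Complex.I * ε) * inner ℂ x (res T (t + Complex.I * ε) x))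
      (𝓝[>] 0) (𝓝 ((scalarSpectralMeasure T x).real {t} : ℂ)) := by
    intro x
    refine (tendsto_integral_kernel (scalarSpectralMeasure T x) t).congr' ?_
    filter_upwards [self_mem_nhdsWithin] with ε (hε : 0 < ε)
    rw [inner_res_self hT (by rw [add_I_mul_im]; exact hε.ne')]
  rw [inner_spectralMeasure, polarForm]
  simp_rw [← linearCombination_polar _ v w, Finsupp.linearCombination_apply, Finsupp.sum,
    Finset.mul_sum]
  refine tendsto_finsetSum _ fun x _ => ?_
  simpa [mul_left_comm] using (hself x).const_mul (polar v w x)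

/-- With R = (T - t - iε)⁻¹ one has (T - t)R = 1 + iεR. Multiplied by -iε, the right side tends
weakly to 0, while moving T - t across the inner product identifies the limit of the left side. -/
theorem apply_spectralMeasure_singleton {T : H →L[ℂ] H} (hT : IsSelfAdjoint T)
    (t : ℝ) (w : H) : T (spectralMeasure T {t} w) = (t : ℂ) • spectralMeasure T {t} w := by
  refine ext_inner_left ℂ fun v => ?_
  rw [← sub_eq_zero, ← inner_sub_right]
  have hsym : ∀ u : H, inner ℂ v (T u - (t : ℂ) • u) = inner ℂ (T v - (t : ℂ) • v) u := by
    intro u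
    have := hT.isSymmetric v u
    simp only [ContinuousLinearMap.coe_coe] at this
    rw [inner_sub_left, inner_sub_right, inner_smul_left, inner_smul_right, this,
      Complex.conj_ofReal]
  rw [hsym]
  refine tendsto_nhds_unique (tendsto_inner_res hT t (T v - (t : ℂ) • v) w) ?_
  have h1 : Tendsto (fun ε : ℝ => -(Complex.I * ε) * inner ℂ v w +
      (Complex.I * ε) * (-(Complex.I * ε) * inner ℂ v (res T (t + Complex.I * ε) w)))
      (𝓝[>] 0) (𝓝 (-(Complex.I * ((0 : ℝ) : ℂ)) * inner ℂ v w +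
        (Complex.I * ((0 : ℝ) : ℂ)) * inner ℂ v (spectralMeasure T {t} w))) := by
    have h0 : Tendsto (fun ε : ℝ => Complex.I * (ε : ℂ)) (𝓝[>] 0)
        (𝓝 (Complex.I * ((0 : ℝ) : ℂ))) :=
      (Continuous.tendsto (by fun_prop) 0).mono_left nhdsWithin_le_nhds
    exact (h0.neg.mul_const _).add (h0.mul (tendsto_inner_res hT t v w))
  simp only [Complex.ofReal_zero, mul_zero, neg_zero, zero_mul, add_zero] at h1
  refine h1.congr' ?_
  filter_upwards [self_mem_nhdsWithin] with ε (hε : 0 < ε)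
  have h := sub_smul_res_apply hT (z := t + Complex.I * ε)
    (by rw [add_I_mul_im]; exact hε.ne') w
  have h2 : T (res T (t + Complex.I * ε) w) - (t : ℂ) • res T (t + Complex.I * ε) w
      = w + (Complex.I * ε) • res T (t + Complex.I * ε) w := by
    rw [add_smul, ← sub_sub, sub_eq_iff_eq_add] at h
    exact h
  rw [← hsym, h2, inner_add_right, inner_smul_right]
  ring

theorem exists_eigenvector_of_scalarSpectralMeasure_singleton_ne_zero {T : H →L[ℂ] H}
    (hT : IsSelfAdjoint T) {t : ℝ} {x : H} (h : scalarSpectralMeasure T x {t} ≠ 0) :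
    ∃ w : H, w ≠ 0 ∧ T w = (t : ℂ) • w := by
  refine ⟨spectralMeasure T {t} x, fun h0 => h ?_, apply_spectralMeasure_singleton hT t x⟩
  have h1 := inner_spectralMeasure_self T {t} x
  rw [h0, inner_zero_right, eq_comm, Complex.ofReal_eq_zero] at h1
  exact (measureReal_eq_zero_iff (measure_ne_top _ _)).1 h1

/-- For an eigenvector w, ⟪w, x⟫ = ⟪w, (T - t - iε)Rx⟫ = -iε⟪w, Rx⟫ with R = (T - t - iε)⁻¹, so the
approximating quantity is constant in ε. -/
theorem inner_spectralMeasure_of_eigenvector {T : H →L[ℂ] H} (hT : IsSelfAdjoint T) {t : ℝ}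
    {w : H} (hw : T w = (t : ℂ) • w) (x : H) :
    inner ℂ w (spectralMeasure T {t} x) = inner ℂ w x := by
  refine tendsto_nhds_unique (tendsto_inner_res hT t w x) ?_
  refine tendsto_const_nhds.congr' ?_
  filter_upwards [self_mem_nhdsWithin] with ε (hε : 0 < ε)
  have h := sub_smul_res_apply hT (z := t + Complex.I * ε)
    (by rw [add_I_mul_im]; exact hε.ne') x
  have hsym := hT.isSymmetric w (res T (t + Complex.I * ε) x)
  simp only [ContinuousLinearMap.coe_coe] at hsym
  conv_lhs => rw [← h]
  rw [inner_sub_right, ← hsym, hw, inner_smul_left, inner_smul_right, Complex.conj_ofReal]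
  ring

/-- As E({t})x is itself an eigenvector, ⟪E({t})x, x⟫ = ‖E({t})x‖². A vanishing atom thus forces
E({t})x = 0, and ⟪w, x⟫ = ⟪w, E({t})x⟫. -/
theorem inner_eigenvector_eq_zero {T : H →L[ℂ] H} (hT : IsSelfAdjoint T) {t : ℝ} {x w : H}
    (hw : T w = (t : ℂ) • w) (h : scalarSpectralMeasure T x {t} = 0) : inner ℂ w x = 0 := by
  have h1 := inner_spectralMeasure_self T {t} x
  rw [Measure.real, h, ENNReal.toReal_zero, Complex.ofReal_zero, ← inner_conj_symm,
    map_eq_zero, ← inner_spectralMeasure_of_eigenvector hT (apply_spectralMeasure_singleton hT t x),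
    inner_self_eq_zero] at h1
  rw [← inner_spectralMeasure_of_eigenvector hT hw, h1, inner_zero_right]

end Resolvent

/-! ### Schur complement, eigenvectors of the block operator and atoms of ω. -/

section Schur

theorem inclusion_apply {H₀ H₁ : Type*} [NormedAddCommGroup H₀] [InnerProductSpace ℂ H₀]
    [NormedAddCommGroup H₁] [InnerProductSpace ℂ H₁] (y : H₁) :
    inclusion H₀ H₁ y = WithLp.toLp 2 (0, y) := rfl

variable {H₀ H₁ : Type*}
  [NormedAddCommGroup H₀] [InnerProductSpace ℂ H₀] [CompleteSpace H₀]
  [NormedAddCommGroup H₁] [InnerProductSpace ℂ H₁] [CompleteSpace H₁]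

theorem adjoint_inclusion_apply (w : WithLp 2 (H₀ × H₁)) :
    ContinuousLinearMap.adjoint (inclusion H₀ H₁) w = w.snd := by
  refine ext_inner_left ℂ fun v => ?_
  rw [ContinuousLinearMap.adjoint_inner_right, inclusion_apply, WithLp.prod_inner_apply]
  simp

theorem schurInverse_eq {A₀ : H₀ →L[ℂ] H₀} {A₁ : H₁ →L[ℂ] H₁} (V : H₁ →L[ℂ] H₀)
    (hA₀ : IsSelfAdjoint A₀) (hA₁ : IsSelfAdjoint A₁) {z : ℂ} (hz : z.im ≠ 0) :
    schurInverse A₀ A₁ V z = ContinuousLinearMap.adjoint (inclusion H₀ H₁) ∘L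
      res (blockOperator A₀ A₁ V) z ∘L inclusion H₀ H₁ := by
  have hB := blockOperator_isSelfAdjoint hA₀ hA₁ V
  set S : H₁ →L[ℂ] H₁ := (A₁ - z • ContinuousLinearMap.id ℂ H₁) -
    ContinuousLinearMap.adjoint V ∘L res A₀ z ∘L V with hS
  set N : H₁ →L[ℂ] H₁ := ContinuousLinearMap.adjoint (inclusion H₀ H₁) ∘L
      res (blockOperator A₀ A₁ V) z ∘L inclusion H₀ H₁ with hN
  -- For w = (B - z)⁻¹Jh the first row gives w₀ = -(A₀ - z)⁻¹Vw₁; substituting this in the second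
  -- row yields S w₁ = h.
  have h1 : S * N = 1 := by
    ext h
    set w := res (blockOperator A₀ A₁ V) z (inclusion H₀ H₁ h) with hw
    have h2 := sub_smul_res_apply hB hz (inclusion H₀ H₁ h)
    rw [← hw, blockOperator_apply, inclusion_apply] at h2
    have h3 : A₀ w.fst + V w.snd - z • w.fst = 0 := congrArg WithLp.fst h2
    have h4 : ContinuousLinearMap.adjoint V w.fst + A₁ w.snd - z • w.snd = h :=
      congrArg WithLp.snd h2
    have h5 : w.fst = - res A₀ z (V w.snd) := by
      rw [← res_sub_smul_apply hA₀ hz w.fst, ← map_neg]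
      congr 1
      rw [eq_neg_iff_add_eq_zero, ← h3]
      abel
    have h6 : N h = w.snd := by
      rw [hN, ContinuousLinearMap.comp_apply, ContinuousLinearMap.comp_apply,
        adjoint_inclusion_apply]
    change S (N h) = h
    rw [h6, ← h4, h5, hS]
    simp only [sub_apply, smul_apply, ContinuousLinearMap.comp_apply,
      ContinuousLinearMap.id_apply, map_neg]
    abel
  -- Conversely, B - z sends (-(A₀ - z)⁻¹Vy, y) to J(Sy).
  have h2 : N * S = 1 := by
    ext y
    have h3 := res_sub_smul_apply hB hz (WithLp.toLp 2 (-res A₀ z (V y), y))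
    have h4 : blockOperator A₀ A₁ V (WithLp.toLp 2 (-res A₀ z (V y), y)) -
        z • WithLp.toLp 2 (-res A₀ z (V y), y) = inclusion H₀ H₁ (S y) := by
      rw [blockOperator_apply, inclusion_apply, ← WithLp.toLp_smul, ← WithLp.toLp_sub]
      congr 1
      refine Prod.ext ?_ ?_
      · change A₀ (-res A₀ z (V y)) + V y - z • (-res A₀ z (V y)) = 0
        rw [map_neg, smul_neg, sub_neg_eq_add, neg_add_eq_sub, sub_add_eq_add_sub, sub_eq_zero]
        exact (sub_eq_iff_eq_add.1 (sub_smul_res_apply hA₀ hz (V y))).symm ▸ rfl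
      · change ContinuousLinearMap.adjoint V (-res A₀ z (V y)) + A₁ y - z • y = S y
        rw [hS]
        simp only [sub_apply, smul_apply, ContinuousLinearMap.comp_apply,
          ContinuousLinearMap.id_apply, map_neg]
        abel
    rw [h4] at h3
    change N (S y) = y
    rw [hN, ContinuousLinearMap.comp_apply, ContinuousLinearMap.comp_apply, h3,
      adjoint_inclusion_apply]
    rfl
  exact Ring.inverse_unit ⟨S, N, h1, h2⟩

theorem inner_schurInverse_self {A₀ : H₀ →L[ℂ] H₀} {A₁ : H₁ →L[ℂ] H₁} (V : H₁ →L[ℂ] H₀)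
    (hA₀ : IsSelfAdjoint A₀) (hA₁ : IsSelfAdjoint A₁) {z : ℂ} (hz : z.im ≠ 0) (v : H₁) :
    inner ℂ v (schurInverse A₀ A₁ V z v) = ∫ s : ℝ, ((s : ℂ) - z)⁻¹
      ∂(scalarSpectralMeasure (blockOperator A₀ A₁ V) (inclusion H₀ H₁ v)) := by
  rw [schurInverse_eq V hA₀ hA₁ hz, ContinuousLinearMap.comp_apply, ContinuousLinearMap.comp_apply,
    ContinuousLinearMap.adjoint_inner_right,
    inner_res_self (blockOperator_isSelfAdjoint hA₀ hA₁ V) hz]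

theorem blockOperator_apply_eq_smul_iff (A₀ : H₀ →L[ℂ] H₀) (A₁ : H₁ →L[ℂ] H₁)
    (V : H₁ →L[ℂ] H₀) (z : ℂ) (w : WithLp 2 (H₀ × H₁)) :
    blockOperator A₀ A₁ V w = z • w ↔ A₀ w.fst + V w.snd = z • w.fst ∧
      ContinuousLinearMap.adjoint V w.fst + A₁ w.snd = z • w.snd := by
  rw [blockOperator_apply]
  constructor
  · intro h
    exact ⟨congrArg WithLp.fst h, congrArg WithLp.snd h⟩
  · rintro ⟨h1, h2⟩
    rw [h1, h2]
    rfl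

/-- Moving powers of A₀ onto the eigenvector u gives ⟪u, A₀ᵏVy⟫ = tᵏ⟪V*u, y⟫ = 0, so u is orthogonal
to a dense set. -/
theorem eq_zero_of_eigenvector_of_adjoint_eq_zero {A₀ : H₀ →L[ℂ] H₀} {V : H₁ →L[ℂ] H₀}
    (hA₀ : IsSelfAdjoint A₀)
    (hV : IsCyclicGeneratingSubspace A₀ (LinearMap.range (V : H₁ →ₗ[ℂ] H₀)))
    {t : ℝ} {u : H₀} (hu : A₀ u = (t : ℂ) • u) (hVu : ContinuousLinearMap.adjoint V u = 0) :
    u = 0 := by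
  have key : ∀ (k : ℕ) (y : H₁), inner ℂ u ((A₀ ^ k) (V y)) = 0 := by
    intro k y
    induction k with
    | zero =>
      rw [pow_zero, one_apply_eq_self, ← ContinuousLinearMap.adjoint_inner_left, hVu,
        inner_zero_left]
    | succ k ih =>
      have := hA₀.isSymmetric u ((A₀ ^ k) (V y))
      simp only [ContinuousLinearMap.coe_coe] at this
      rw [pow_succ', mul_apply_eq_comp, ← this, hu, inner_smul_left, ih, mul_zero]
  refine Dense.eq_zero_of_inner_left ℂ hV fun w hw => ?_
  induction hw using Submodule.span_induction with
  | mem w h =>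
    obtain ⟨k, _, ⟨y, rfl⟩, rfl⟩ := h
    exact key k y
  | zero => exact inner_zero_right _
  | add a b _ _ ha hb => rw [inner_add_right, ha, hb, add_zero]
  | smul c a _ ha => rw [inner_smul_right, ha, mul_zero]

theorem tendsto_of_tendsto_inner {ι E : Type*} [NormedAddCommGroup E] [InnerProductSpace ℂ E]
    [FiniteDimensional ℂ E] {l : Filter ι} {f : ι → E} {a : E}
    (h : ∀ v, Tendsto (fun i => inner ℂ v (f i)) l (𝓝 (inner ℂ v a))) :
    Tendsto f l (𝓝 a) := by
  set b := stdOrthonormalBasis ℂ E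
  have hf : f = fun i => ∑ j, (inner ℂ (b j) (f i) : ℂ) • b j :=
    funext fun i => (b.sum_repr' (f i)).symm
  rw [hf, ← b.sum_repr' a]
  exact tendsto_finsetSum _ fun j _ => (h (b j)).smul_const _

/-- Here (A₀ - t - iε)⁻¹(A₀ - t)u = u + iε(A₀ - t - iε)⁻¹u tends only weakly to u - E({t})u; after
V* the convergence takes place in a finite-dimensional space, where weak and norm convergence agree.
-/
theorem tendsto_adjoint_res [FiniteDimensional ℂ H₁] {A₀ : H₀ →L[ℂ] H₀} (V : H₁ →L[ℂ] H₀)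
    (hA₀ : IsSelfAdjoint A₀) (t : ℝ) (u : H₀) :
    Tendsto (fun ε : ℝ => ContinuousLinearMap.adjoint V
      (res A₀ (t + Complex.I * ε) (A₀ u - (t : ℂ) • u))) (𝓝[>] 0)
      (𝓝 (ContinuousLinearMap.adjoint V (u - spectralMeasure A₀ {t} u))) := by
  refine tendsto_of_tendsto_inner fun v => ?_
  rw [ContinuousLinearMap.adjoint_inner_right, inner_sub_right]
  refine ((tendsto_inner_res hA₀ t (V v) u).const_sub _).congr' ?_
  filter_upwards [self_mem_nhdsWithin] with ε (hε : 0 < ε)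
  have hz : ((t : ℂ) + Complex.I * ε).im ≠ 0 := by rw [add_I_mul_im]; exact hε.ne'
  have h := res_sub_smul_apply hA₀ hz u
  rw [add_smul, ← sub_sub, map_sub, map_smul, sub_eq_iff_eq_add] at h
  rw [ContinuousLinearMap.adjoint_inner_right, h, inner_add_right, inner_smul_right]
  ring

theorem mem_pointSet_iff [FiniteDimensional ℂ H₁] {A₀ : H₀ →L[ℂ] H₀} {A₁ : H₁ →L[ℂ] H₁}
    {V : H₁ →L[ℂ] H₀} (hA₀ : IsSelfAdjoint A₀) {t : ℝ} :
    t ∈ pointSet A₀ A₁ V ↔ ∃ w : WithLp 2 (H₀ × H₁), w.snd ≠ 0 ∧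
      blockOperator A₀ A₁ V w = (t : ℂ) • w := by
  simp_rw [blockOperator_apply_eq_smul_iff]
  constructor
  · rintro ⟨y, hy, ⟨u, hu⟩, x, ⟨p, rfl⟩, l, hl, h⟩
    rw [hu] at hl
    have hl' := tendsto_nhds_unique hl (tendsto_adjoint_res V hA₀ t u)
    -- With Vy = (A₀ - t)u, the vector -u solves the first row up to the eigenspace of A₀ at t. The
    -- projections E({t})p and E({t})u adjust it within that eigenspace so that the second row
    -- holds.
    refine ⟨WithLp.toLp 2 (spectralMeasure A₀ {t} p + spectralMeasure A₀ {t} u - u, y), hy, ?_, ?_⟩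
    · change A₀ (spectralMeasure A₀ {t} p + spectralMeasure A₀ {t} u - u) + V y
        = (t : ℂ) • (spectralMeasure A₀ {t} p + spectralMeasure A₀ {t} u - u)
      simp only [map_sub, map_add, apply_spectralMeasure_singleton hA₀, hu, smul_sub, smul_add]
      abel
    · change ContinuousLinearMap.adjoint V
        (spectralMeasure A₀ {t} p + spectralMeasure A₀ {t} u - u) + A₁ y = (t : ℂ) • y
      rw [hl', sub_eq_iff_eq_add] at h
      rw [h]
      simp only [map_sub, map_add]
      abel
  · rintro ⟨w, hw, h1, h2⟩
    have hu : V w.snd = A₀ (-w.fst) - (t : ℂ) • (-w.fst) := by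
      rw [map_neg, smul_neg, ← h1]
      abel
    refine ⟨w.snd, hw, ⟨-w.fst, hu⟩, spectralMeasure A₀ {t} w.fst, ⟨w.fst, rfl⟩,
      ContinuousLinearMap.adjoint V (-w.fst - spectralMeasure A₀ {t} (-w.fst)), ?_, ?_⟩
    · rw [hu]
      exact tendsto_adjoint_res V hA₀ t _
    · rw [← h2]
      simp only [map_sub, map_neg]
      abel

/-- If no basis vector Jeᵢ gave an atom at t, an eigenvector would be orthogonal to all of them and
its H₁-component would vanish. Conversely an atom yields an eigenvector, whose H₁-component is
nonzero by cyclicity. -/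
theorem pointSet_eq_atoms [FiniteDimensional ℂ H₁] {A₀ : H₀ →L[ℂ] H₀} {A₁ : H₁ →L[ℂ] H₁}
    {V : H₁ →L[ℂ] H₀} (hA₀ : IsSelfAdjoint A₀) (hA₁ : IsSelfAdjoint A₁)
    (hV : IsCyclicGeneratingSubspace A₀ (LinearMap.range (V : H₁ →ₗ[ℂ] H₀))) :
    pointSet A₀ A₁ V = atoms (omega A₀ A₁ V) := by
  have hB := blockOperator_isSelfAdjoint hA₀ hA₁ V
  ext t
  rw [mem_pointSet_iff hA₀, atoms, Set.mem_ofPred_eq, omega, Measure.coe_finsetSum,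
    Finset.sum_apply, Ne, Finset.sum_eq_zero_iff]
  push Not
  constructor
  · rintro ⟨w, hw, h⟩
    by_contra! hcon
    refine hw ?_
    rw [← (stdOrthonormalBasis ℂ H₁).sum_repr' w.snd]
    refine Finset.sum_eq_zero fun i hi => ?_
    have h0 := inner_eigenvector_eq_zero hB h (hcon i hi)
    rw [← ContinuousLinearMap.adjoint_inner_left, adjoint_inclusion_apply] at h0
    rw [← inner_conj_symm, h0, map_zero, zero_smul]
  · rintro ⟨i, -, hi⟩
    obtain ⟨w, hw, h⟩ := exists_eigenvector_of_scalarSpectralMeasure_singleton_ne_zero hB hi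
    refine ⟨w, fun h0 => hw ?_, h⟩
    rw [blockOperator_apply_eq_smul_iff, h0, map_zero, map_zero, add_zero, add_zero,
      smul_zero] at h
    exact WithLp.ofLp_injective 2
      (Prod.ext (eq_zero_of_eigenvector_of_adjoint_eq_zero hA₀ hV h.1 h.2) h0)

end Schur

/-! ### Herglotz functions cannot blow up on a set of positive Lebesgue measure. -/

section BoundaryValues

/-- Halving the argument, which lies between 0 and π, puts the principal root in the closed first
quadrant. -/
theorem exists_first_quadrant_sqrt {F : ℂ → ℂ} {U : Set ℂ} (hd : DifferentiableOn ℂ F U)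
    (him : ∀ z ∈ U, 0 < (F z).im) :
    ∃ g : ℂ → ℂ, DifferentiableOn ℂ g U ∧
      ∀ z ∈ U, g z * g z = F z ∧ 0 ≤ (g z).re ∧ 0 ≤ (g z).im := by
  refine ⟨fun z => Complex.exp (Complex.log (F z) / 2), ?_, fun z hz => ⟨?_, ?_, ?_⟩⟩
  · exact ((hd.clog fun z hz => Complex.mem_slitPlane_iff.2 (Or.inr (him z hz).ne')).div_const 2).cexp
  · rw [← Complex.exp_add, add_halves, Complex.exp_log]
    intro h
    exact (him z hz).ne' (by rw [h, Complex.zero_im])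
  · have h1 : 0 ≤ (F z).arg := Complex.arg_nonneg_iff.2 (him z hz).le
    have h2 := Complex.arg_le_pi (F z)
    rw [Complex.exp_re]
    refine mul_nonneg (Real.exp_pos _).le (Real.cos_nonneg_of_mem_Icc ?_)
    simp only [Complex.div_ofNat_im, Complex.log_im]
    constructor <;> linarith
  · have h1 : 0 ≤ (F z).arg := Complex.arg_nonneg_iff.2 (him z hz).le
    have h2 := Complex.arg_le_pi (F z)
    rw [Complex.exp_im]
    refine mul_nonneg (Real.exp_pos _).le (Real.sin_nonneg_of_nonneg_of_le_pi ?_ ?_) <;>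
    simp only [Complex.div_ofNat_im, Complex.log_im] <;> linarith

theorem norm_integral_vertical_le {g : ℂ → ℂ} {D : ℝ}
    (hg : ∀ z : ℂ, 0 < z.im → z.im ≤ 1 → ‖g z‖ ≤ D * z.im ^ (-(1 / 2) : ℝ)) (hD : 0 ≤ D)
    (a : ℝ) {ε : ℝ} (hε : 0 < ε) (hε1 : ε ≤ 1) :
    ‖∫ y in ε..1, g (a + y * Complex.I)‖ ≤ 2 * D := by
  have h0 : (0 : ℝ) ∉ Set.uIcc ε 1 := by
    rw [Set.uIcc_of_le hε1]
    exact fun h => hε.not_ge h.1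
  calc ‖∫ y in ε..1, g (a + y * Complex.I)‖ ≤ ∫ y in ε..1, D * y ^ (-(1 / 2) : ℝ) := by
        refine intervalIntegral.norm_integral_le_of_norm_le hε1 (ae_of_all _ fun y hy => ?_)
          ((intervalIntegral.intervalIntegrable_rpow (Or.inr h0)).const_mul D)
        have := hg (a + y * Complex.I) (by simpa using hε.trans hy.1) (by simpa using hy.2)
        simpa using this
    _ = D * (2 * (1 - ε ^ (1 / 2 : ℝ))) := by
        rw [intervalIntegral.integral_const_mul, integral_rpow (Or.inl (by norm_num)),
          Real.one_rpow]
        norm_num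
        ring_nf
        simp
    _ ≤ 2 * D := by
        have := Real.rpow_nonneg hε.le (1 / 2 : ℝ)
        nlinarith

/-- The integral of g along height ε is compared with that along height 1. The vertical sides stay
bounded because the root turns the bound C/Im z into an integrable singularity of order (Im
z)^(-1/2). -/
theorem exists_integral_sqrt_norm_le {F : ℂ → ℂ} (hd : DifferentiableOn ℂ F {z | 0 < z.im})
    (him : ∀ z : ℂ, 0 < z.im → 0 ≤ (F z).im) {C : ℝ} (hC : ∀ z : ℂ, 0 < z.im → ‖F z‖ ≤ C / z.im)
    {a b : ℝ} (hab : a ≤ b) :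
    ∃ K, ∀ ε : ℝ, 0 < ε → ε ≤ 1 → ∫ x in a..b, √‖F (x + Complex.I * ε)‖ ≤ K := by
  obtain ⟨g, hgd, hg⟩ := exists_first_quadrant_sqrt (F := fun z => F z + Complex.I)
    (hd.add_const _) (fun z hz => by
      have := him z hz
      simp only [Complex.add_im, Complex.I_im]
      linarith)
  have hC0 : 0 ≤ C := by
    have := (norm_nonneg _).trans (hC Complex.I (by simp))
    simpa using this
  -- For Im z ≤ 1, |F + i| ≤ C/Im z + 1 ≤ (C + 1)/Im z.
  set D := √(C + 1) with hDdef
  have hD : 0 ≤ D := Real.sqrt_nonneg _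
  have hnorm : ∀ z : ℂ, 0 < z.im → ‖g z‖ ^ 2 = ‖F z + Complex.I‖ := fun z hz => by
    rw [pow_two, ← norm_mul, (hg z hz).1]
  have hgb : ∀ z : ℂ, 0 < z.im → z.im ≤ 1 → ‖g z‖ ≤ D * z.im ^ (-(1 / 2) : ℝ) := by
    intro z hz hz1
    have h1 : ‖g z‖ ^ 2 ≤ (C + 1) / z.im := by
      rw [hnorm z hz]
      refine (norm_add_le _ _).trans ?_
      rw [Complex.norm_I, add_div]
      exact add_le_add (hC z hz) ((one_le_div hz).2 hz1)
    refine (Real.le_sqrt_of_sq_le h1).trans_eq ?_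
    rw [Real.sqrt_div (by linarith), Real.rpow_neg hz.le, ← Real.sqrt_eq_rpow, div_eq_mul_inv]
  have hpath : ∀ ε : ℝ, 0 < ε → Continuous fun x : ℝ => g (x + Complex.I * ε) := by
    intro ε hε
    refine hgd.continuousOn.comp_continuous (by fun_prop) fun x => ?_
    simpa using hε
  have hpathF : ∀ ε : ℝ, 0 < ε → Continuous fun x : ℝ => F (x + Complex.I * ε) := by
    intro ε hε
    refine hd.continuousOn.comp_continuous (by fun_prop) fun x => ?_
    simpa using hε
  -- The top side contributes D(b - a) and the two vertical sides 2D each; the factor 2 accounts for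
  -- Re and Im, and the last b - a for the 1 in √|F| ≤ |g| + 1.
  refine ⟨2 * (D * (b - a) + 4 * D) + (b - a), fun ε hε hε1 => ?_⟩
  have hrect := Complex.integral_boundary_rect_eq_zero_of_differentiableOn g
    (a + ε * Complex.I) (b + (1 : ℝ) * Complex.I) (hgd.mono fun z hz => by
      have := hz.2
      simp only [Complex.add_im, Complex.ofReal_im, Complex.mul_im, Complex.ofReal_re,
        Complex.I_im, Complex.I_re, mul_one, mul_zero, add_zero, zero_add, Set.mem_preimage] at this
      rw [Set.uIcc_of_le hε1] at this
      exact hε.trans_le this.1)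
  simp only [Complex.add_im, Complex.ofReal_im, Complex.mul_im, Complex.ofReal_re, Complex.add_re,
    Complex.mul_re, Complex.I_im, Complex.I_re, mul_one, mul_zero, add_zero, zero_add, sub_self]
    at hrect
  have htop : ‖∫ x in a..b, g (x + (1 : ℝ) * Complex.I)‖ ≤ D * (b - a) := by
    have := intervalIntegral.norm_integral_le_of_norm_le_const (a := a) (b := b) (C := D)
      (f := fun x : ℝ => g (x + (1 : ℝ) * Complex.I)) fun x _ => by
        have := hgb (x + (1 : ℝ) * Complex.I) (by simp) (by simp)
        simpa using this
    rwa [abs_of_nonneg (sub_nonneg.2 hab)] at this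
  have hbot : ‖∫ x in a..b, g (x + ε * Complex.I)‖ ≤ D * (b - a) + 4 * D := by
    have h1 := norm_integral_vertical_le hgb hD a hε hε1
    have h2 := norm_integral_vertical_le hgb hD b hε hε1
    have h3 : ∫ x in a..b, g (x + ε * Complex.I) = (∫ x in a..b, g (x + (1 : ℝ) * Complex.I))
        - Complex.I • (∫ y in ε..1, g (b + y * Complex.I))
        + Complex.I • (∫ y in ε..1, g (a + y * Complex.I)) := by
      linear_combination hrect
    rw [h3]
    refine (norm_add_le_of_le (norm_sub_le_of_le htop (?_ : _ ≤ 2 * D))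
      (?_ : _ ≤ 2 * D)).trans_eq (by ring)
    · rwa [norm_smul, Complex.norm_I, one_mul]
    · rwa [norm_smul, Complex.norm_I, one_mul]
  simp_rw [mul_comm (ε : ℂ)] at hbot
  have hI := (hpath ε hε).intervalIntegrable (μ := volume) a b
  calc ∫ x in a..b, √‖F (x + Complex.I * ε)‖
      ≤ ∫ x in a..b, (((g (x + Complex.I * ε)).re + (g (x + Complex.I * ε)).im) + 1) := by
        refine intervalIntegral.integral_mono_on hab ?_ ?_ fun x _ => ?_
        · exact ((hpathF ε hε).norm.sqrt).intervalIntegrable _ _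
        · exact (((Complex.continuous_re.comp (hpath ε hε)).add
            (Complex.continuous_im.comp (hpath ε hε))).add continuous_const).intervalIntegrable _ _
        · have hz : 0 < ((x : ℂ) + Complex.I * ε).im := by simpa using hε
          set z := (x : ℂ) + Complex.I * ε
          have h1 : ‖F z‖ ≤ ‖g z‖ ^ 2 + 1 := by
            rw [hnorm z hz]
            calc ‖F z‖ = ‖(F z + Complex.I) - Complex.I‖ := by rw [add_sub_cancel_right]
              _ ≤ _ := by
                refine (norm_sub_le _ _).trans_eq ?_
                rw [Complex.norm_I]
          have h2 : ‖g z‖ ≤ (g z).re + (g z).im := by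
            have := Complex.norm_le_abs_re_add_abs_im (g z)
            rwa [abs_of_nonneg (hg z hz).2.1, abs_of_nonneg (hg z hz).2.2] at this
          refine (Real.sqrt_le_iff.2 ⟨by positivity, ?_⟩ : _ ≤ ‖g z‖ + 1).trans (by linarith)
          nlinarith [norm_nonneg (g z)]
    _ = (∫ x in a..b, g (x + Complex.I * ε)).re + (∫ x in a..b, g (x + Complex.I * ε)).im
          + (b - a) := by
        rw [intervalIntegral.integral_add _ intervalIntegrable_const, intervalIntegral.integral_add,
          intervalIntegral.integral_const, smul_eq_mul, mul_one]
        · congr 2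
          · exact Complex.reCLM.intervalIntegral_comp_comm hI
          · exact Complex.imCLM.intervalIntegral_comp_comm hI
        · exact (Complex.continuous_re.comp (hpath ε hε)).intervalIntegrable _ _
        · exact (Complex.continuous_im.comp (hpath ε hε)).intervalIntegrable _ _
        · exact ((Complex.continuous_re.comp (hpath ε hε)).add
            (Complex.continuous_im.comp (hpath ε hε))).intervalIntegrable _ _
    _ ≤ _ := by
        have h1 := Complex.re_le_norm (∫ x in a..b, g (x + Complex.I * ε))
        have h2 := (le_abs_self _).trans
          (Complex.abs_im_le_norm (∫ x in a..b, g (x + Complex.I * ε)))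
        linarith

theorem volume_setOf_tendsto_sum_sqrt_norm_atTop {ι : Type*} (s : Finset ι) {F : ι → ℂ → ℂ}
    (hd : ∀ i, DifferentiableOn ℂ (F i) {z | 0 < z.im})
    (him : ∀ i, ∀ z : ℂ, 0 < z.im → 0 ≤ (F i z).im) {C : ι → ℝ}
    (hC : ∀ i, ∀ z : ℂ, 0 < z.im → ‖F i z‖ ≤ C i / z.im) :
    volume {t : ℝ | Tendsto (fun ε : ℝ => ∑ i ∈ s, √‖F i (t + Complex.I * ε)‖)
      (𝓝[>] 0) atTop} = 0 := by
  set e : ℕ → ℝ := fun n => 1 / ((n : ℝ) + 1) with he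
  have he0 : ∀ n, 0 < e n := fun n => by positivity
  have he1 : ∀ n, e n ≤ 1 := fun n => by
    rw [he]
    exact div_le_one_of_le₀ (by simp) (by positivity)
  have hlim : Tendsto e atTop (𝓝[>] 0) :=
    tendsto_nhdsWithin_iff.2 ⟨tendsto_one_div_add_atTop_nhds_zero_nat, .of_forall he0⟩
  set Y : ℕ → ℝ → ℝ := fun n t => ∑ i ∈ s, √‖F i (t + Complex.I * e n)‖ with hY
  have hYi : ∀ i n, Continuous fun t : ℝ => √‖F i (t + Complex.I * e n)‖ := fun i n => by
    refine (Continuous.norm ?_).sqrt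
    refine (hd i).continuousOn.comp_continuous (by fun_prop) fun x => ?_
    simpa using he0 n
  have hYc : ∀ n, Continuous (Y n) := fun n => continuous_finsetSum _ fun i _ => hYi i n
  -- Fatou's lemma along the heights 1/(n + 1), on each bounded interval.
  have key : ∀ N : ℕ, volume.restrict (Set.Icc (-(N : ℝ)) N)
      {t | liminf (fun n => ENNReal.ofReal (Y n t)) atTop = ⊤} = 0 := by
    intro N
    have hN : -(N : ℝ) ≤ N := by linarith [N.cast_nonneg (α := ℝ)]
    choose K hK using fun i => exists_integral_sqrt_norm_le (hd i) (him i) (hC i) hN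
    have hmeas : ∀ n, Measurable fun t => ENNReal.ofReal (Y n t) := fun n =>
      (hYc n).measurable.ennreal_ofReal
    have hle : ∫⁻ t in Set.Icc (-(N : ℝ)) N, liminf (fun n => ENNReal.ofReal (Y n t)) atTop
        ≤ ENNReal.ofReal (∑ i ∈ s, K i) := by
      refine (lintegral_liminf_le hmeas).trans ?_
      refine liminf_le_of_le (by isBoundedDefault) fun c hc => ?_
      obtain ⟨n, hn⟩ := hc.exists
      refine hn.trans ?_
      rw [← ofReal_integral_eq_lintegral_ofReal ((hYc n).integrableOn_Icc)
        (ae_of_all _ fun t => Finset.sum_nonneg fun i _ => Real.sqrt_nonneg _)]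
      refine ENNReal.ofReal_le_ofReal ?_
      rw [integral_finsetSum _ fun i _ => (hYi i n).integrableOn_Icc]
      refine Finset.sum_le_sum fun i _ => ?_
      rw [integral_Icc_eq_integral_Ioc, ← intervalIntegral.integral_of_le hN]
      exact hK i (e n) (he0 n) (he1 n)
    have := ae_lt_top (Measurable.liminf hmeas) (hle.trans_lt ENNReal.ofReal_lt_top).ne
    simpa only [ae_iff, not_lt, top_le_iff] using this
  refine measure_mono_null (t := ⋃ N : ℕ, {t | liminf (fun n => ENNReal.ofReal (Y n t)) atTop = ⊤}
    ∩ Set.Icc (-(N : ℝ)) N) (fun t ht => ?_) (measure_iUnion_null fun N => ?_)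
  · obtain ⟨N, hN⟩ := exists_nat_ge |t|
    refine Set.mem_iUnion.2 ⟨N, ?_, abs_le.1 hN⟩
    exact (ENNReal.tendsto_ofReal_nhds_top.2 (ht.comp hlim)).liminf_eq
  · rw [← Measure.restrict_apply' measurableSet_Icc]
    exact key N

end BoundaryValues

/-! ### Analyticity, size and positivity of the diagonal resolvent entries. -/

section ResolventForm

variable {H : Type*} [NormedAddCommGroup H] [InnerProductSpace ℂ H] [CompleteSpace H]

theorem differentiableAt_res {T : H →L[ℂ] H} (hT : IsSelfAdjoint T) {z : ℂ} (hz : z.im ≠ 0) :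
    DifferentiableAt ℂ (res T) z :=
  DifferentiableAt.comp (𝕜 := ℂ) z (differentiableAt_inverse (isUnit_sub_smul_id hT hz))
    (by fun_prop : DifferentiableAt ℂ (fun z : ℂ => T - z • ContinuousLinearMap.id ℂ H) z)

theorem im_inner_res_self {T : H →L[ℂ] H} (hT : IsSelfAdjoint T) {z : ℂ} (hz : z.im ≠ 0) (x : H) :
    (inner ℂ x (res T z x)).im =
      ∫ s : ℝ, z.im / ((s - z.re) ^ 2 + z.im ^ 2) ∂(scalarSpectralMeasure T x) := by
  rw [inner_res_self hT hz]
  refine (integral_im (𝕜 := ℂ) (integrable_inv_ofReal_sub _ hz)).symm.trans ?_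
  refine integral_congr_ae (ae_of_all _ fun s => ?_)
  simp [Complex.normSq_apply, pow_two]

theorem norm_inner_res_self_le {T : H →L[ℂ] H} (hT : IsSelfAdjoint T) {z : ℂ} (hz : 0 < z.im)
    (x : H) : ‖inner ℂ x (res T z x)‖ ≤ (scalarSpectralMeasure T x).real Set.univ / z.im := by
  rw [inner_res_self hT hz.ne']
  refine (norm_integral_le_of_norm_le_const
    (ae_of_all _ fun s => norm_inv_ofReal_sub_le s hz.ne')).trans_eq ?_
  rw [abs_of_pos hz, mul_comm, div_eq_mul_inv]

/-- The imaginary part integrates ε/((s - t)² + ε²), which is at least 1/(2ε) when |s - t| ≤ ε. -/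
theorem measureReal_closedBall_le {T : H →L[ℂ] H} (hT : IsSelfAdjoint T) (t : ℝ) {ε : ℝ}
    (hε : 0 < ε) (x : H) : (scalarSpectralMeasure T x).real (Metric.closedBall t ε) / (2 * ε) ≤
      (inner ℂ x (res T (t + Complex.I * ε) x)).im := by
  rw [im_inner_res_self hT (by rw [add_I_mul_im]; exact hε.ne'), add_I_mul_im]
  have hre : ((t : ℂ) + Complex.I * ε).re = t := by simp
  rw [hre]
  calc _ = ∫ s, (Metric.closedBall t ε).indicator (fun _ => 1 / (2 * ε)) s
        ∂(scalarSpectralMeasure T x) := by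
        rw [integral_indicator_const _ measurableSet_closedBall, smul_eq_mul, mul_one_div]
    _ ≤ _ := by
        refine integral_mono ((integrable_const _).indicator measurableSet_closedBall)
          ((integrable_const ε⁻¹).mono' (continuous_const_div t ε hε.ne').aestronglyMeasurable
            (ae_of_all _ fun s => ?_)) fun s => ?_
        · rw [Real.norm_of_nonneg (by positivity), div_le_iff₀ (by positivity)]
          have : ε⁻¹ * ε ^ 2 = ε := by field_simp
          nlinarith [mul_nonneg (inv_nonneg.2 hε.le) (sq_nonneg (s - t))]
        · refine Set.indicator_apply_le' (fun hs => ?_) fun _ => by positivity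
          rw [Metric.mem_closedBall, Real.dist_eq] at hs
          have h2 : (s - t) ^ 2 ≤ ε ^ 2 := sq_le_sq' (abs_le.1 hs).1 (abs_le.1 hs).2
          rw [div_le_div_iff₀ (by positivity) (by positivity)]
          nlinarith

end ResolventForm

/-! ### The set S_s: it is null, Borel, and carries the singular part of ω. -/

section Singular

variable {H₀ H₁ : Type*}
  [NormedAddCommGroup H₀] [InnerProductSpace ℂ H₀] [CompleteSpace H₀]
  [NormedAddCommGroup H₁] [InnerProductSpace ℂ H₁] [CompleteSpace H₁]

/-- Polarization writes each matrix entry through diagonal values at finitely many vectors chosen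
independently of M. This brings ‖M(z)‖ within reach of scalar Herglotz functions. -/
theorem exists_norm_le_sum_norm_inner_self (E : Type*) [NormedAddCommGroup E]
    [InnerProductSpace ℂ E] [FiniteDimensional ℂ E] :
    ∃ (s : Finset E) (C : ℝ), 0 ≤ C ∧
      ∀ M : E →L[ℂ] E, ‖M‖ ≤ C * ∑ v ∈ s, ‖inner ℂ v (M v)‖ := by
  classical
  have := FiniteDimensional.complete ℂ E
  set b := stdOrthonormalBasis ℂ E
  set s : Finset E := Finset.univ.biUnion fun i => Finset.univ.biUnion fun j =>
    (polar (b i) (b j)).support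
  set c : _ → _ → ℝ := fun i j => ∑ v ∈ s, ‖polar (b i) (b j) v‖
  have hentry : ∀ (M : E →L[ℂ] E) i j,
      ‖inner ℂ (b i) (M (b j))‖ ≤ c i j * ∑ v ∈ s, ‖inner ℂ v (M v)‖ := by
    intro M i j
    have hsub : (polar (b i) (b j)).support ⊆ s := fun v hv =>
      Finset.mem_biUnion.2 ⟨i, Finset.mem_univ _, Finset.mem_biUnion.2 ⟨j, Finset.mem_univ _, hv⟩⟩
    rw [← linearCombination_polar M (b i) (b j), Finsupp.linearCombination_apply,
      Finsupp.sum_of_support_subset _ hsub _ (by simp), Finset.sum_mul]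
    refine norm_sum_le_of_le _ fun v hv => ?_
    rw [norm_smul]
    gcongr
    exact Finset.single_le_sum (f := fun v => ‖inner ℂ v (M v)‖) (fun _ _ => norm_nonneg _) hv
  refine ⟨s, ∑ j, ∑ i, c i j, by positivity, fun M => ?_⟩
  refine M.opNorm_le_bound (by positivity) fun x => ?_
  have hx : M x = ∑ j, (inner ℂ (b j) x : ℂ) • M (b j) := by
    conv_lhs => rw [← b.sum_repr' x, map_sum]
    simp only [map_smul]
  rw [hx, Finset.sum_mul, Finset.sum_mul]
  refine norm_sum_le_of_le _ fun j _ => ?_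
  have h1 : ‖M (b j)‖ ≤ (∑ i, c i j) * ∑ v ∈ s, ‖inner ℂ v (M v)‖ := by
    rw [← b.sum_repr' (M (b j)), Finset.sum_mul]
    refine norm_sum_le_of_le _ fun i _ => ?_
    rw [norm_smul, b.norm_eq_one, mul_one]
    exact hentry M i j
  rw [norm_smul, mul_comm]
  gcongr
  exact (norm_inner_le_norm _ _).trans_eq (by rw [b.norm_eq_one, one_mul])

theorem volume_singularSet [FiniteDimensional ℂ H₁] {A₀ : H₀ →L[ℂ] H₀} {A₁ : H₁ →L[ℂ] H₁}
    (V : H₁ →L[ℂ] H₀) (hA₀ : IsSelfAdjoint A₀) (hA₁ : IsSelfAdjoint A₁) :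
    volume (singularSet A₀ A₁ V) = 0 := by
  have hB := blockOperator_isSelfAdjoint hA₀ hA₁ V
  obtain ⟨s, C, hC0, hC⟩ := exists_norm_le_sum_norm_inner_self H₁
  set F : H₁ → ℂ → ℂ := fun v z =>
    inner ℂ (inclusion H₀ H₁ v) (res (blockOperator A₀ A₁ V) z (inclusion H₀ H₁ v))
  refine measure_mono_null (fun t ht => ?_) (volume_setOf_tendsto_sum_sqrt_norm_atTop s (F := F)
    (fun v z hz => ?_) (fun v z hz => ?_) (fun v z hz => norm_inner_res_self_le hB hz _))
  · refine tendsto_atTop.2 fun K => ?_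
    filter_upwards [self_mem_nhdsWithin, ht.eventually_gt_atTop (C * K ^ 2)] with ε
      (hε : 0 < ε) hK
    by_contra! hlt
    have hz : ((t : ℂ) + Complex.I * ε).im ≠ 0 := by rw [add_I_mul_im]; exact hε.ne'
    refine hK.not_ge ((hC _).trans (mul_le_mul_of_nonneg_left ?_ hC0))
    calc ∑ v ∈ s, ‖inner ℂ v (schurInverse A₀ A₁ V (t + Complex.I * ε) v)‖
        = ∑ v ∈ s, √‖F v (t + Complex.I * ε)‖ ^ 2 := by
          refine Finset.sum_congr rfl fun v _ => ?_
          rw [inner_schurInverse_self V hA₀ hA₁ hz, Real.sq_sqrt (norm_nonneg _),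
            ← inner_res_self hB hz]
      -- If the sum of the roots stayed at most K, the sum of the moduli would be at most K²,
      -- against the chosen threshold C · K² for the norm.
      _ ≤ (∑ v ∈ s, √‖F v (t + Complex.I * ε)‖) ^ 2 :=
          Finset.sum_sq_le_sq_sum_of_nonneg fun _ _ => Real.sqrt_nonneg _
      _ ≤ K ^ 2 := by
          gcongr
  · have h1 : DifferentiableAt ℂ (fun z => res (blockOperator A₀ A₁ V) z (inclusion H₀ H₁ v)) z :=
      (differentiableAt_res hB (ne_of_gt hz)).clm_apply (differentiableAt_const _)
    exact ((innerSL ℂ (inclusion H₀ H₁ v)).differentiableAt.comp z h1).differentiableWithinAt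
  · change 0 ≤ (inner ℂ _ (res _ z _)).im
    rw [im_inner_res_self hB hz.ne']
    exact integral_nonneg fun s => by positivity

theorem omega_real_closedBall_le [FiniteDimensional ℂ H₁] {A₀ : H₀ →L[ℂ] H₀} {A₁ : H₁ →L[ℂ] H₁}
    (V : H₁ →L[ℂ] H₀) (hA₀ : IsSelfAdjoint A₀) (hA₁ : IsSelfAdjoint A₁) (t : ℝ) {ε : ℝ}
    (hε : 0 < ε) : (omega A₀ A₁ V).real (Metric.closedBall t ε) / (2 * ε) ≤
      Module.finrank ℂ H₁ * ‖schurInverse A₀ A₁ V (t + Complex.I * ε)‖ := by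
  have hB := blockOperator_isSelfAdjoint hA₀ hA₁ V
  have hz : ((t : ℂ) + Complex.I * ε).im ≠ 0 := by rw [add_I_mul_im]; exact hε.ne'
  rw [omega, Measure.real, Measure.coe_finsetSum, Finset.sum_apply,
    ENNReal.toReal_sum fun v _ => measure_ne_top _ _, Finset.sum_div]
  calc _ ≤ ∑ i : Fin (Module.finrank ℂ H₁), ‖schurInverse A₀ A₁ V (t + Complex.I * ε)‖ := by
        refine Finset.sum_le_sum fun i _ => ?_
        refine (measureReal_closedBall_le hB t hε _).trans ?_
        rw [inner_res_self hB hz, ← inner_schurInverse_self V hA₀ hA₁ hz]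
        refine (le_abs_self _).trans ((Complex.abs_im_le_norm _).trans
          ((norm_inner_le_norm _ _).trans ?_))
        rw [OrthonormalBasis.norm_eq_one, one_mul]
        refine (ContinuousLinearMap.le_opNorm _ _).trans_eq ?_
        rw [OrthonormalBasis.norm_eq_one, mul_one]
    _ = _ := by simp

instance [FiniteDimensional ℂ H₁] (A₀ : H₀ →L[ℂ] H₀) (A₁ : H₁ →L[ℂ] H₁) (V : H₁ →L[ℂ] H₀) :
    IsFiniteMeasure (omega A₀ A₁ V) := by
  unfold omega; infer_instance

theorem singularPart_compl_singularSet [FiniteDimensional ℂ H₁] {A₀ : H₀ →L[ℂ] H₀}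
    {A₁ : H₁ →L[ℂ] H₁} (V : H₁ →L[ℂ] H₀) (hA₀ : IsSelfAdjoint A₀) (hA₁ : IsSelfAdjoint A₁) :
    (omega A₀ A₁ V).singularPart volume (singularSet A₀ A₁ V)ᶜ = 0 := by
  set ω := omega A₀ A₁ V
  have hac : ω.singularPart volume ≪ ω := (Measure.singularPart_le ω volume).absolutelyContinuous
  -- Lebesgue measure is differentiated with respect to ω, not the reverse: this derivative vanishes
  -- almost everywhere for the singular part, and inverting the quotient gives divergence.
  have h0 : volume.rnDeriv ω =ᵐ[ω.singularPart volume] 0 :=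
    Measure.rnDeriv_eq_zero_of_mutuallySingular (Measure.mutuallySingular_singularPart _ _).symm hac
  refine mem_ae_iff.1 ?_
  filter_upwards [h0, hac.ae_le (Besicovitch.ae_tendsto_rnDeriv volume ω)] with t ht0 ht
  rw [ht0, Pi.zero_apply] at ht
  have h1 := tendsto_inv_iff.2 ht
  rw [ENNReal.inv_zero] at h1
  have h2 : Tendsto (fun ε : ℝ => ENNReal.ofReal (Module.finrank ℂ H₁ *
      ‖schurInverse A₀ A₁ V (t + Complex.I * ε)‖)) (𝓝[>] 0) (𝓝 ⊤) := by
    refine tendsto_nhds_top_mono h1 ?_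
    filter_upwards [self_mem_nhdsWithin] with ε (hε : 0 < ε)
    refine le_trans (le_of_eq ?_) (ENNReal.ofReal_le_ofReal
      (omega_real_closedBall_le V hA₀ hA₁ t hε))
    rw [Real.volume_closedBall, ENNReal.inv_div (Or.inl (measure_ne_top _ _)) (Or.inr (by simpa)),
      ENNReal.ofReal_div_of_pos (by positivity), ofReal_measureReal]
  have h3 := ENNReal.tendsto_ofReal_nhds_top.1 h2
  have hn : (0 : ℝ) ≤ Module.finrank ℂ H₁ := by positivity
  -- If dim H₁ = 0 the bound is identically 0 and cannot diverge, so the case is contradictory.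
  rcases hn.eq_or_lt with h | h
  · simp only [← h, zero_mul] at h3
    exact absurd h3 (not_tendsto_const_atTop _ _)
  · exact (tendsto_const_mul_atTop_of_pos h).1 h3

/-- Continuity in ε lets rational ε test the lower bounds, leaving countably many closed conditions
on t. -/
theorem measurableSet_setOf_tendsto_atTop {f : ℝ → ℝ → ℝ}
    (hf : ContinuousOn f.uncurry (Set.univ ×ˢ Set.Ioi 0)) :
    MeasurableSet {t | Tendsto (f t) (𝓝[>] 0) atTop} := by
  have h1 : ∀ t, ContinuousOn (f t) (Set.Ioi 0) := fun t =>
    hf.comp (f := fun ε => (t, ε)) (by fun_prop) fun ε hε => ⟨Set.mem_univ _, hε⟩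
  have h2 : ∀ ε > 0, Continuous fun t => f t ε := fun ε hε =>
    hf.comp_continuous (f := fun t => (t, ε)) (by fun_prop) fun t => ⟨Set.mem_univ _, hε⟩
  have key : {t | Tendsto (f t) (𝓝[>] 0) atTop} =
      ⋂ n : ℕ, ⋃ m : ℕ, ⋂ q : ℚ, ⋂ (_ : 0 < (q : ℝ)), ⋂ (_ : (q : ℝ) < 1 / (m + 1)),
        {t | (n : ℝ) ≤ f t q} := by
    ext t
    simp only [Set.mem_iInter, Set.mem_iUnion]
    constructor
    · intro h n
      obtain ⟨δ, hδ, hsub⟩ := mem_nhdsGT_iff_exists_Ioo_subset.1 (h.eventually_ge_atTop (n : ℝ))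
      obtain ⟨m, hm⟩ := exists_nat_one_div_lt (show (0 : ℝ) < δ from hδ)
      exact ⟨m, fun q hq hqm => hsub ⟨hq, hqm.trans hm⟩⟩
    · intro h
      refine tendsto_atTop.2 fun K => ?_
      obtain ⟨n, hn⟩ := exists_nat_ge K
      obtain ⟨m, hm⟩ := h n
      have hpos : (0 : ℝ) < 1 / (m + 1) := by positivity
      filter_upwards [Ioo_mem_nhdsGT hpos] with ε hε
      refine hn.trans ?_
      by_contra! hlt
      have h3 : {x | f t x < n} ∈ 𝓝 ε :=
        ((h1 t).continuousAt (Ioi_mem_nhds hε.1)).eventually_lt_const hlt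
      have h4 := inter_mem h3 (Ioo_mem_nhds hε.1 hε.2)
      obtain ⟨_, ⟨q, rfl⟩, h5, h6⟩ := Rat.denseRange_cast.inter_nhds_nonempty h4
      exact not_lt.2 (show (n : ℝ) ≤ f t q from hm q h6.1 h6.2) h5
  rw [key]
  refine .iInter fun n => .iUnion fun m => .iInter fun q => .iInter fun hq => .iInter fun _ => ?_
  exact measurableSet_le measurable_const (h2 q hq).measurable

theorem measurableSet_singularSet {A₀ : H₀ →L[ℂ] H₀}
    {A₁ : H₁ →L[ℂ] H₁} (V : H₁ →L[ℂ] H₀) (hA₀ : IsSelfAdjoint A₀) (hA₁ : IsSelfAdjoint A₁) :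
    MeasurableSet (singularSet A₀ A₁ V) := by
  have hB := blockOperator_isSelfAdjoint hA₀ hA₁ V
  refine measurableSet_setOf_tendsto_atTop ?_
  have hres : ContinuousOn (fun p : ℝ × ℝ => res (blockOperator A₀ A₁ V) (p.1 + Complex.I * p.2))
      (Set.univ ×ˢ Set.Ioi 0) := by
    rintro ⟨t, ε⟩ ⟨-, hε⟩
    refine ContinuousAt.continuousWithinAt ?_
    refine ContinuousAt.comp (f := fun p : ℝ × ℝ => (p.1 : ℂ) + Complex.I * p.2)
      (differentiableAt_res hB ?_).continuousAt (by fun_prop)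
    rw [add_I_mul_im]
    exact ne_of_gt hε
  refine ((continuousOn_const.clm_comp (hres.clm_comp
    (continuousOn_const (c := inclusion H₀ H₁)))).norm (f := fun p : ℝ × ℝ =>
      ContinuousLinearMap.adjoint (inclusion H₀ H₁) ∘L
      res (blockOperator A₀ A₁ V) (p.1 + Complex.I * p.2) ∘L inclusion H₀ H₁)).congr ?_
  rintro ⟨t, ε⟩ ⟨-, hε⟩
  change ‖schurInverse A₀ A₁ V _‖ = _
  rw [schurInverse_eq V hA₀ hA₁ (by rw [add_I_mul_im]; exact ne_of_gt hε)]

theorem isMinimalSupport_of_volume_eq_zero {S : Set ℝ} {μ : Measure ℝ} (hS : IsSupport S μ)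
    (h : volume S = 0) : IsMinimalSupport S μ :=
  ⟨hS, fun _ _ _ => measure_mono_null Set.sdiff_subset h⟩

theorem singularPart_singleton (μ : Measure ℝ) [IsFiniteMeasure μ] (t : ℝ) :
    μ.singularPart volume {t} = μ {t} := by
  have h := congrArg (fun ν : Measure ℝ => ν {t}) (Measure.haveLebesgueDecomposition_add μ volume)
  have h0 : volume.withDensity (μ.rnDeriv volume) {t} = 0 :=
    withDensity_absolutelyContinuous _ _ (measure_singleton t)
  simpa [h0] using h.symm

theorem countable_atoms (μ : Measure ℝ) [IsFiniteMeasure μ] : (atoms μ).Countable := by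
  have h := Measure.countable_meas_pos_of_disjoint_iUnion (μ := μ) (As := fun t : ℝ => {t})
    (fun t => measurableSet_singleton t)
    fun _ _ h => Set.disjoint_singleton.2 h
  exact h.mono fun t ht => pos_iff_ne_zero.2 ht

end Singular

end BlockOperator

theorem mainTheorem4 {H₀ H₁ : Type*}
    [NormedAddCommGroup H₀] [InnerProductSpace ℂ H₀] [CompleteSpace H₀]
    [NormedAddCommGroup H₁] [InnerProductSpace ℂ H₁] [CompleteSpace H₁]
    [FiniteDimensional ℂ H₁]
    (A₀ : H₀ →L[ℂ] H₀) (A₁ : H₁ →L[ℂ] H₁) (V : H₁ →L[ℂ] H₀)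
    (hA₀ : IsSelfAdjoint A₀) (hA₁ : IsSelfAdjoint A₁)
    (hV : BlockOperator.IsCyclicGeneratingSubspace A₀ (LinearMap.range (V : H₁ →ₗ[ℂ] H₀))) :
    BlockOperator.IsMinimalSupport (BlockOperator.singularSet A₀ A₁ V)
        ((BlockOperator.omega A₀ A₁ V).singularPart volume) ∧
      BlockOperator.pointSet A₀ A₁ V = BlockOperator.atoms (BlockOperator.omega A₀ A₁ V) ∧
      BlockOperator.IsMinimalSupport
        (BlockOperator.singularSet A₀ A₁ V \ BlockOperator.pointSet A₀ A₁ V)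
        (BlockOperator.singularContinuousPart (BlockOperator.omega A₀ A₁ V)) := by
  have hmeas := BlockOperator.measurableSet_singularSet V hA₀ hA₁
  have hvol := BlockOperator.volume_singularSet V hA₀ hA₁
  have hsing := BlockOperator.singularPart_compl_singularSet V hA₀ hA₁
  have hpt := BlockOperator.pointSet_eq_atoms hA₀ hA₁ hV
  refine ⟨BlockOperator.isMinimalSupport_of_volume_eq_zero ⟨hmeas, hsing⟩ hvol, hpt,
    BlockOperator.isMinimalSupport_of_volume_eq_zero ⟨?_, ?_⟩
      (measure_mono_null Set.sdiff_subset hvol)⟩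
  · rw [hpt]
    exact hmeas.diff (BlockOperator.countable_atoms _).measurableSet
  -- Lebesgue measure has no atoms, so ω and its singular part share theirs.
  · have hat : BlockOperator.atoms ((BlockOperator.omega A₀ A₁ V).singularPart volume)
        = BlockOperator.pointSet A₀ A₁ V := by
      rw [hpt]
      simp only [BlockOperator.atoms, BlockOperator.singularPart_singleton]
    rw [BlockOperator.singularContinuousPart, hat, Measure.restrict_apply']
    · refine measure_mono_null ?_ hsing
      rintro t ⟨h1, h2⟩ h3
      exact h1 ⟨h3, h2⟩
    · rw [hpt]
      exact (BlockOperator.countable_atoms _).measurableSet.compl
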